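/- Theorem (Dimension inequality for structure from motion). Let $N$ (points), $M$ (individual camera parameters), $\Theta$ (global camera parameters) and $S$ (retinal surface) be real-analytic manifolds (Hausdorff, second countable, without boundary) of dimensions $d$, $f$, $h$, $s$. Every $(\theta,c)\in\Theta\times M$ determines a camera, that is, a map $Q=Q_{\theta,c}:N\to N$ with $Q^2=Q$, together with a diffeomorphism of $S$ onto the embedded submanifold $Q(N)\subseteq N$; through it the picture $Q(P)$ of a point $P\in N$ is regarded as an element of $S$. Let $G$ be a Lie group (second countable) of dimension $g$ acting smoothly on $N$, $M$ and $\Theta$ without changing the pictures: the picture of $\gamma P$ taken by the camera $(\gamma\theta,\gamma c)$ equals the picture of $P$ taken by $(\theta,c)$, for all $\gamma,\theta,c,P$. For $n$ points and $m$ cameras let $X=\Theta\times M^m\times N^n$ be the configuration space with the diagonal action of $G$, and let $$F:X\to S^{mn},\qquad F(\theta,Q_1,\dots,Q_m,P_1,\dots,P_n)=(Q_j(P_i))_{j,i}$$ be the structure from motion map. Let $U\subseteq X$ be an open set on which $F$ is real analytic, and assume that all $G$-orbits of points of $U$ have the same dimension (the dimension of the orbit $Gx$ is the rank at $1$ of the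 differential of $\gamma\mapsto\gamma x$). (1) Call $x\in U$ locally recoverable if $x$ has a neighbourhood in which every $y$ with $F(y)=F(x)$ lies in the orbit $Gx$. If the set of locally recoverable configurations in $U$ is not a Lebesgue null set, then $$dn+fm+h\le s\,nm+g .$$ In particular this inequality is necessary if $U\neq\emptyset$ and all configurations in $U$ can be recovered up to symmetry from their images. (2) Suppose that $dn+fm+h=s\,nm+g$. For $x\in U$ let $\det(DF)(x)$ denote the determinant, in some bases, of the linear map $T_xX/T_x(Gx)\to T_{F(x)}S^{mn}$ induced by the differential of $F$ (so $\det(DF)(x)\ne0$ means that this map is an isomorphism). Say that $F$ is locally uniquely invertible at $x$ if there are open neighbourhoods $W$ of $x$ and $V$ of $F(x)$ with $F(W)\subseteq V$ and a real-analytic map $\sigma:V\to W$ with $F\circ\sigma=\mathrm{id}_V$, $\sigma(F(x))=x$, and $y\in G\,\sigma(F(y))$ for all $y\in W$. If $\det(DF)$ is not identically zero on $U$, then for almost every $p\in F(U)$ the map $F$ is locally uniquely invertible at every $x\in U$ with $F(x)=p$: the set of the other $p\in F(U)$ is a Lebesgue null set in $S^{mn}$. Moreover, on every connected component of $U$ on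 which $\det(DF)$ is not identically zero, $F$ is locally uniquely invertible at almost every $x$. -/

import Mathlib

open scoped Manifold ContDiff
open Set

namespace StructureFromMotion

section Generic

/-- A subset `A` of a finite-dimensional manifold (modelled on `E` through `I`) is a null set if
its image in every preferred chart is a Lebesgue null set. -/
def IsNullSet {E H X : Type*} [NormedAddCommGroup E] [NormedSpace ℝ E] [MeasureTheory.MeasureSpace E]
    [TopologicalSpace H] (I : ModelWithCorners ℝ E H) [TopologicalSpace X] [ChartedSpace H X]
    (A : Set X) : Prop :=
  ∀ x : X, MeasureTheory.volume (extChartAt I x '' (A ∩ (extChartAt I x).source)) = 0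

/-- The tangent space at `x` of the orbit `G • x`: the image of the differential at `1` of the
orbit map `γ ↦ γ • x`. -/
noncomputable def orbitTangent {EG HG E H X : Type*}
    [NormedAddCommGroup EG] [NormedSpace ℝ EG] [TopologicalSpace HG]
    (IG : ModelWithCorners ℝ EG HG)
    [NormedAddCommGroup E] [NormedSpace ℝ E] [TopologicalSpace H] (I : ModelWithCorners ℝ E H)
    (G : Type*) [TopologicalSpace G] [ChartedSpace HG G] [Group G]
    [TopologicalSpace X] [ChartedSpace H X] [MulAction G X] (x : X) :
    Submodule ℝ (TangentSpace I x) :=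
  LinearMap.range (mfderiv IG I (fun γ : G => γ • x) 1).toLinearMap

/-- The dimension of the orbit `G • x`. -/
noncomputable def orbitDim {EG HG E H X : Type*}
    [NormedAddCommGroup EG] [NormedSpace ℝ EG] [TopologicalSpace HG]
    (IG : ModelWithCorners ℝ EG HG)
    [NormedAddCommGroup E] [NormedSpace ℝ E] [TopologicalSpace H] (I : ModelWithCorners ℝ E H)
    (G : Type*) [TopologicalSpace G] [ChartedSpace HG G] [Group G]
    [TopologicalSpace X] [ChartedSpace H X] [MulAction G X] (x : X) : ℕ :=
  Module.finrank ℝ (orbitTangent IG I G x)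

/-- The configuration `x` can be locally recovered, up to symmetry, from its image `F x`: every
configuration near `x` with the same image lies in the `G`-orbit of `x`. -/
def LocallyRecoverableAt {X Y : Type*} (G : Type*) [Group G] [TopologicalSpace X] [MulAction G X]
    (F : X → Y) (x : X) : Prop :=
  ∃ W ∈ nhds x, ∀ y ∈ W, F y = F x → y ∈ MulAction.orbit G x

/-- `det (DF) ≠ 0` at `x`, where the symmetries are factored out: the differential of `F` at `x`
induces a linear map from `T_x X` modulo the tangent space of the orbit to the tangent space at
`F x`, and the matrix of this map in some (equivalently, any) bases is square with non-zero
determinant. -/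
def JacobianDetNeZero {EG HG E H E' H' X Y : Type*}
    [NormedAddCommGroup EG] [NormedSpace ℝ EG] [TopologicalSpace HG]
    (IG : ModelWithCorners ℝ EG HG)
    [NormedAddCommGroup E] [NormedSpace ℝ E] [TopologicalSpace H] (I : ModelWithCorners ℝ E H)
    [NormedAddCommGroup E'] [NormedSpace ℝ E'] [TopologicalSpace H']
    (J : ModelWithCorners ℝ E' H')
    (G : Type*) [TopologicalSpace G] [ChartedSpace HG G] [Group G]
    [TopologicalSpace X] [ChartedSpace H X] [MulAction G X]
    [TopologicalSpace Y] [ChartedSpace H' Y] (F : X → Y) (x : X) : Prop :=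
  ∃ L : (TangentSpace I x ⧸ orbitTangent IG I G x) →ₗ[ℝ] TangentSpace J (F x),
    L ∘ₗ (orbitTangent IG I G x).mkQ = (mfderiv I J F x).toLinearMap ∧
    ∃ (r : ℕ) (b : Module.Basis (Fin r) ℝ (TangentSpace I x ⧸ orbitTangent IG I G x))
      (b' : Module.Basis (Fin r) ℝ (TangentSpace J (F x))),
      (LinearMap.toMatrix b b' L).det ≠ 0

/-- Near `x` the map `F` can be inverted in a locally unique way modulo the symmetry group: `F`
maps an open neighbourhood `W` of `x` into an open neighbourhood `V` of `F x`, there is a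
real-analytic map `σ : V → W` with `F ∘ σ = id` and `σ (F x) = x`, and every `y ∈ W` agrees with
`σ (F y)` up to an element of `G`. -/
def LocallyUniquelyInvertibleAt {E H E' H' X Y : Type*}
    [NormedAddCommGroup E] [NormedSpace ℝ E] [TopologicalSpace H] (I : ModelWithCorners ℝ E H)
    [NormedAddCommGroup E'] [NormedSpace ℝ E'] [TopologicalSpace H']
    (J : ModelWithCorners ℝ E' H')
    (G : Type*) [Group G]
    [TopologicalSpace X] [ChartedSpace H X] [MulAction G X]
    [TopologicalSpace Y] [ChartedSpace H' Y] (F : X → Y) (x : X) : Prop :=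
  ∃ (W : Set X) (V : Set Y) (σ : Y → X),
    IsOpen W ∧ x ∈ W ∧ IsOpen V ∧ MapsTo F W V ∧ MapsTo σ V W ∧
    ContMDiffOn J I ω σ V ∧ σ (F x) = x ∧ (∀ p ∈ V, F (σ p) = p) ∧
    ∀ y ∈ W, y ∈ MulAction.orbit G (σ (F y))

end Generic

/-- A type of cameras on the `d`-dimensional point manifold `N`, with retinal surface `S`. Every
value `θ ∈ Θ` of the global parameters and every value `c ∈ M` of the individual camera parameters
determine a camera, that is, an idempotent map `Q : N → N`, together with a diffeomorphism of the
fixed manifold `S` onto its retinal surface `Q(N) ⊆ N`. -/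
structure CameraType (d s : ℕ) (Θ M N S : Type*)
    [TopologicalSpace N] [ChartedSpace (EuclideanSpace ℝ (Fin d)) N]
    [TopologicalSpace S] [ChartedSpace (EuclideanSpace ℝ (Fin s)) S] where
  /-- the camera, as a map of the point manifold to itself -/
  cam : Θ → M → N → N
  cam_idem : ∀ θ c P, cam θ c (cam θ c P) = cam θ c P
  /-- the parametrization of the retinal surface `Q(N)` by `S` -/
  retina : Θ → M → S → N
  retina_embedding : ∀ θ c, Manifold.IsSmoothEmbedding (𝓡 s) (𝓡 d) ∞ (retina θ c)
  range_retina : ∀ θ c, range (retina θ c) = range (cam θ c)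

/-- The configuration space: global parameters, `m` cameras and `n` points. -/
abbrev Config (Θ M N : Type*) (m n : ℕ) : Type _ := Θ × (Fin m → M) × (Fin n → N)

/-- The model of the configuration space, of dimension `h + f * m + d * n`. -/
noncomputable abbrev configModel (h f d m n : ℕ) :=
  (𝓡 h).prod ((ModelWithCorners.pi fun _ : Fin m => 𝓡 f).prod
    (ModelWithCorners.pi fun _ : Fin n => 𝓡 d))

/-- The model of the space `S ^ (m n)` of image data, of dimension `s * n * m`. -/
noncomputable abbrev imageModel (s m n : ℕ) :=
  ModelWithCorners.pi fun _ : Fin m × Fin n => 𝓡 s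

namespace CameraType

variable {d s : ℕ} {Θ M N S : Type*}
  [TopologicalSpace N] [ChartedSpace (EuclideanSpace ℝ (Fin d)) N]
  [TopologicalSpace S] [ChartedSpace (EuclideanSpace ℝ (Fin s)) S]

theorem exists_retina_eq (C : CameraType d s Θ M N S) (θ : Θ) (c : M) (P : N) :
    ∃ p : S, C.retina θ c p = C.cam θ c P := by
  have hP : C.cam θ c P ∈ range (C.retina θ c) := by
    rw [C.range_retina]
    exact mem_range_self P
  exact hP

/-- The picture of the point `P`: the unique `p ∈ S` which corresponds to the image point `Q(P)`
on the retinal surface. -/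
noncomputable def picture (C : CameraType d s Θ M N S) (θ : Θ) (c : M) (P : N) : S :=
  (C.exists_retina_eq θ c P).choose

theorem retina_picture (C : CameraType d s Θ M N S) (θ : Θ) (c : M) (P : N) :
    C.retina θ c (C.picture θ c P) = C.cam θ c P :=
  (C.exists_retina_eq θ c P).choose_spec

/-- `G` is a group of global symmetries: the pictures do not change when an element of `G` is
applied simultaneously to the cameras and to the points, `γ(Q)(γ(P)) = Q(P)`. -/
def IsSymmetryGroup (C : CameraType d s Θ M N S) (G : Type*) [Group G]
    [MulAction G Θ] [MulAction G M] [MulAction G N] : Prop :=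
  ∀ (γ : G) (θ : Θ) (c : M) (P : N), C.picture (γ • θ) (γ • c) (γ • P) = C.picture θ c P

/-- The structure from motion map: the `m n` pictures which `m` cameras take of `n` points. -/
noncomputable def sfmMap (C : CameraType d s Θ M N S) (m n : ℕ) (x : Config Θ M N m n) :
    Fin m × Fin n → S :=
  fun ji => C.picture x.1 (x.2.1 ji.1) (x.2.2 ji.2)

end CameraType

end StructureFromMotion

/-!
The dimension inequality and the local inversion theorem hold for any map `F : X → Y` between
real-analytic manifolds which is invariant under a Lie group `G` acting on `X` and analytic on an
open set `U`; invariance of the structure from motion map is the hypothesis that symmetries do not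
change the pictures.

Since `F` is analytic, its differential has locally maximal rank almost everywhere on `U`: where the
rank drops below its local maximum `r`, an `r × r` minor that is not identically zero has to vanish,
and zero sets of analytic functions are null sets (`exists_generic_rank`).

*Inequality.* If the locally recoverable configurations do not form a null set, there is one, `x`,
near which the rank is at most its value `r` at `x`. There the rank is constant, so the fibre of `F`
through `x` contains a graph over the kernel of the differential
(`exists_projection_fiber_mem_nhds`), which has dimension `dim X - r ≥ dim X - dim Y`. This graph is
contained in the orbit of `x`, a smooth image of `G`, whose Hausdorff dimension is at most `dim G`.

*Inversion.* A single point where the Jacobian determinant does not vanish forces the (constant)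
orbit dimension to be `dim X - dim Y`. Therefore the determinant is nonzero wherever `DF` is
surjective. At such a point the implicit function theorem gives an analytic section of `F`, and its
image is transverse to the orbit. The map `(γ, q) ↦ γ • σ q` is then a submersion, hence open, so
that every nearby point is a translate of a point of the section
(`locallyUniquelyInvertibleAt_of_mfderivRank_eq`). The points where `DF` is not surjective form a
null set in each component by analyticity (`isNullSet_mfderivRank_lt`). Their images form a null
set too: modulo the symmetries `F` may be restricted to a slice transverse to the orbit, whose
dimension is that of `Y`, and Sard's theorem in equal dimensions applies
(`exists_nhds_isNullSet_image_mfderivRank_lt`). It is here that the orbits of critical points, too,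
need to have the generic dimension.
-/

namespace StructureFromMotion

open scoped Topology
open MeasureTheory Metric Filter Module

/-! ### Zero sets of analytic functions -/

/-- The zero set of an analytic function is a null set near a point `y` where the function does not
vanish. On every segment starting at `y` the zeros are isolated, so by Fubini almost every dilation
about `y` moves almost no point into the zero set. -/
theorem measure_zeroSet_ball_eq_zero {E : Type*} [NormedAddCommGroup E] [NormedSpace ℝ E]
    [FiniteDimensional ℝ E] [MeasurableSpace E] [BorelSpace E] (μ : Measure E) [μ.IsAddHaarMeasure]
    {f : E → ℝ} {e₀ y : E} {ρ : ℝ} (hf : AnalyticOnNhd ℝ f (ball e₀ (5 * ρ)))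
    (hy : y ∈ ball e₀ ρ) (hfy : f y ≠ 0) : μ {x ∈ ball e₀ ρ | f x = 0} = 0 := by
  have hρ : 0 < ρ := pos_of_mem_ball hy
  have hyB : y ∈ ball e₀ (5 * ρ) := ball_subset_ball (by linarith) hy
  set B := ball e₀ (5 * ρ) with hB
  have hcB : Convex ℝ B := convex_ball _ _
  -- the dilations about `y`
  let D : E × ℝ → E := fun p => y + p.2 • (p.1 - y)
  have hD : Continuous D := by fun_prop
  let O : Set (E × ℝ) := B ×ˢ Ioo (1 / 2 : ℝ) 1
  have hO : IsOpen O := isOpen_ball.prod isOpen_Ioo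
  have hDO : MapsTo D O B := by
    rintro ⟨x, t⟩ ⟨hx, ht⟩
    have := hcB.add_smul_sub_mem hyB hx (t := t) ⟨by linarith [ht.1], by linarith [ht.2]⟩
    exact this
  have hcont : ContinuousOn (f ∘ D) O := hf.continuousOn.comp hD.continuousOn hDO
  let Z : Set (E × ℝ) := {p ∈ O | f (D p) = 0}
  have hZ : MeasurableSet Z := by
    have : Z = O \ (O ∩ (f ∘ D) ⁻¹' {0}ᶜ) := by
      ext p; simp only [Z, mem_ofPred_eq, Set.mem_sdiff, mem_inter_iff, mem_preimage, mem_compl_iff,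
        mem_singleton_iff, Function.comp_apply]; tauto
    rw [this]
    exact hO.measurableSet.diff
      (hcont.isOpen_inter_preimage hO isOpen_compl_singleton).measurableSet
  have hZ0 : (μ.prod volume) Z = 0 := by
    rw [Measure.measure_prod_null hZ]
    refine Eventually.of_forall fun x => ?_
    by_cases hx : x ∈ B
    · -- on the segment from `y` to `x` the zeros are isolated
      have han : AnalyticOnNhd ℝ (fun t : ℝ => f (D (x, t))) (Icc 0 1) := by
        intro t ht
        have h1 : AnalyticAt ℝ f (D (x, t)) := hf _ (hcB.add_smul_sub_mem hyB hx ht)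
        have h2 : AnalyticAt ℝ (fun t : ℝ => D (x, t)) t := by
          simp only [D]
          fun_prop
        exact AnalyticAt.fun_comp (g := f) h1 h2
      have hcod := han.preimage_zero_mem_codiscreteWithin (x := 0) (by simpa [D] using hfy)
        (by simp) (isConnected_Icc zero_le_one)
      refine measure_mono_null ?_ 
        ((isCompact_Icc.finite_sdiff_of_mem_codiscreteWithin hcod).measure_zero _)
      rintro t ⟨⟨-, ht⟩, hft⟩
      exact ⟨⟨by linarith [ht.1], ht.2.le⟩, by simpa using hft⟩
    · have : Prod.mk x ⁻¹' Z = ∅ := by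
        ext t; simp [Z, O, hx]
      simp [this]
  -- exchange the variables: for almost every ratio `t` the set `Z` has a null section
  have hZ1 := Measure.ae_ae_of_ae_prod (μ := (volume : Measure ℝ)) (ν := μ)
    (p := fun q => (q.2, q.1) ∉ Z) (by
      have : (volume.prod μ) (Prod.swap ⁻¹' Z) = 0 := by
        rw [← Measure.prod_swap] at hZ0
        rwa [Measure.map_apply measurable_swap hZ] at hZ0
      rw [ae_iff]
      convert this using 2
      ext q
      simp [Prod.swap])
  obtain ⟨t, ht, htZ⟩ : ∃ t ∈ Ioo (1 / 2 : ℝ) 1, ∀ᵐ x ∂μ, (x, t) ∉ Z := by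
    by_contra! hcon
    have : (volume : Measure ℝ) (Ioo (1 / 2) 1) = 0 :=
      measure_mono_null (fun t ht => hcon t ht) hZ1
    simp at this
    norm_num at this
  -- the dilation of ratio `t` maps `B` onto a set which contains the small ball
  have hsub : {x ∈ ball e₀ ρ | f x = 0} ⊆ (fun x => D (x, t)) '' {x | (x, t) ∈ Z} := by
    rintro z ⟨hz, hfz⟩
    have ht0 : (0 : ℝ) < t := by linarith [ht.1]
    have hDz : D (y + t⁻¹ • (z - y), t) = z := by
      simp [D, smul_smul, ht0.ne']
    refine ⟨y + t⁻¹ • (z - y), ⟨⟨?_, ht⟩, ?_⟩, hDz⟩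
    · have ht2 : t⁻¹ ≤ 2 := by
        rw [inv_le_comm₀ ht0 two_pos]; linarith [ht.1]
      have hzy : dist z y < 2 * ρ := by
        have := dist_triangle_right z y e₀
        rw [mem_ball] at hz hy; linarith
      rw [hB, mem_ball]
      calc dist (y + t⁻¹ • (z - y)) e₀ ≤ dist (y + t⁻¹ • (z - y)) y + dist y e₀ :=
            dist_triangle _ _ _
        _ = t⁻¹ * dist z y + dist y e₀ := by
            rw [dist_eq_norm, add_sub_cancel_left, norm_smul, Real.norm_of_nonneg (by positivity),
              dist_eq_norm z y]
        _ < 5 * ρ := by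
            rw [mem_ball] at hy
            have : t⁻¹ * dist z y ≤ 2 * dist z y := by gcongr
            linarith
    · rw [hDz]; exact hfz
  refine measure_mono_null hsub (addHaar_image_eq_zero_of_differentiableOn_of_addHaar_eq_zero μ
    ?_ (by simpa [ae_iff] using htZ))
  simp only [D]
  fun_prop

/-! ### The rank of the differential in vector spaces -/

section Rank
variable {E E' E'' : Type*} [NormedAddCommGroup E] [NormedSpace ℝ E]
  [NormedAddCommGroup E'] [NormedSpace ℝ E'] [NormedAddCommGroup E''] [NormedSpace ℝ E'']

/-- The rank of a continuous linear map, as a natural number. -/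
noncomputable def clmRank (A : E →L[ℝ] E') : ℕ := finrank ℝ (LinearMap.range A.toLinearMap)

theorem clmRank_le_codomain [FiniteDimensional ℝ E'] (A : E →L[ℝ] E') :
    clmRank A ≤ finrank ℝ E' := Submodule.finrank_le _

theorem clmRank_eq_codomain_iff [FiniteDimensional ℝ E'] (A : E →L[ℝ] E') :
    clmRank A = finrank ℝ E' ↔ Function.Surjective A := by
  constructor
  · intro h
    exact LinearMap.range_eq_top.1 (Submodule.eq_top_of_finrank_eq h)
  · intro h
    have : LinearMap.range A.toLinearMap = ⊤ := LinearMap.range_eq_top.2 h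
    rw [clmRank, this, finrank_top]

theorem clmRank_comp_le_left [FiniteDimensional ℝ E''] (B : E' →L[ℝ] E'') (A : E →L[ℝ] E') :
    clmRank (B ∘L A) ≤ clmRank B :=
  Submodule.finrank_mono (LinearMap.range_comp_le_range A.toLinearMap B.toLinearMap)

theorem clmRank_comp_le_right [FiniteDimensional ℝ E'] (B : E' →L[ℝ] E'') (A : E →L[ℝ] E') :
    clmRank (B ∘L A) ≤ clmRank A := by
  have : LinearMap.range (B ∘L A).toLinearMap =
      (LinearMap.range A.toLinearMap).map B.toLinearMap :=
    LinearMap.range_comp A.toLinearMap B.toLinearMap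
  rw [clmRank, this]
  exact Submodule.finrank_map_le _ _

/-- A linear map of rank `r` has an invertible `r × r` minor. -/
theorem exists_linear_sandwich_eq_id [FiniteDimensional ℝ E] [FiniteDimensional ℝ E']
    (A : E →L[ℝ] E') :
    ∃ (ι : (Fin (clmRank A) → ℝ) →L[ℝ] E) (π : E' →L[ℝ] (Fin (clmRank A) → ℝ)),
      ∀ v, π (A (ι v)) = v := by
  let R := LinearMap.range A.toLinearMap
  obtain ⟨p, hp⟩ := LinearMap.exists_leftInverse_of_injective R.subtype R.ker_subtype
  obtain ⟨q, hq⟩ := LinearMap.exists_rightInverse_of_surjective A.toLinearMap.rangeRestrict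
    A.toLinearMap.range_rangeRestrict
  let b : R ≃ₗ[ℝ] (Fin (clmRank A) → ℝ) := LinearEquiv.ofFinrankEq _ _ (by
    rw [finrank_fin_fun]; rfl)
  refine ⟨(q ∘ₗ b.symm.toLinearMap).toContinuousLinearMap,
    (b.toLinearMap ∘ₗ p).toContinuousLinearMap, fun v => ?_⟩
  have h1 : A.toLinearMap.rangeRestrict (q (b.symm v)) = b.symm v := LinearMap.congr_fun hq _
  have h2 : A (q (b.symm v)) = R.subtype (b.symm v) := congrArg Subtype.val h1
  have h3 : p (R.subtype (b.symm v)) = b.symm v := LinearMap.congr_fun hp _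
  change b (p (A (q (b.symm v)))) = v
  rw [h2, h3, LinearEquiv.apply_symm_apply]

/-- Near a point of analyticity the differential of a map has its maximal rank almost everywhere:
where it drops, a minor which is not identically zero has to vanish. -/
theorem exists_generic_rank [FiniteDimensional ℝ E] [FiniteDimensional ℝ E'] [MeasurableSpace E]
    [BorelSpace E] (μ : Measure E) [μ.IsAddHaarMeasure] {F : E → E'} {e₀ : E}
    (hF : AnalyticAt ℝ F e₀) :
    ∃ (r : ℕ) (ρ : ℝ), 0 < ρ ∧ (∀ e ∈ ball e₀ ρ, clmRank (fderiv ℝ F e) ≤ r) ∧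
      μ {e ∈ ball e₀ ρ | clmRank (fderiv ℝ F e) < r} = 0 := by
  obtain ⟨R, hR, hFR⟩ := hF.exists_ball_analyticOnNhd
  -- the factor that `measure_zeroSet_ball_eq_zero` asks for
  set ρ := R / 5 with hρ
  have hρ0 : 0 < ρ := by positivity
  have hR5 : R = 5 * ρ := by rw [hρ]; ring
  rw [hR5] at hFR
  obtain ⟨y, hy, hmax⟩ : ∃ y ∈ ball e₀ ρ, ∀ e ∈ ball e₀ ρ,
      clmRank (fderiv ℝ F e) ≤ clmRank (fderiv ℝ F y) := by
    have hne : ((fun e => clmRank (fderiv ℝ F e)) '' ball e₀ ρ).Nonempty :=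
      (nonempty_ball.2 hρ0).image _
    have hbdd : BddAbove ((fun e => clmRank (fderiv ℝ F e)) '' ball e₀ ρ) :=
      ⟨finrank ℝ E', by rintro _ ⟨e, -, rfl⟩; exact clmRank_le_codomain _⟩
    obtain ⟨y, hy, hy'⟩ := Nat.sSup_mem hne hbdd
    exact ⟨y, hy, fun e he => (le_csSup hbdd (mem_image_of_mem _ he)).trans_eq hy'.symm⟩
  refine ⟨clmRank (fderiv ℝ F y), ρ, hρ0, hmax, ?_⟩
  have hsand := exists_linear_sandwich_eq_id (fderiv ℝ F y)
  generalize clmRank (fderiv ℝ F y) = r at hsand hmax ⊢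
  obtain ⟨ι, π, hιπ⟩ := hsand
  let C : E → (Fin r → ℝ) →L[ℝ] (Fin r → ℝ) := fun e => π ∘L fderiv ℝ F e ∘L ι
  -- an analytic minor of the differential, which does not vanish at `y`
  let m : E → ℝ := fun e => (LinearMap.toMatrix' (C e).toLinearMap).det
  have hm : AnalyticOnNhd ℝ m (ball e₀ (5 * ρ)) := by
    intro e he
    have hd : AnalyticAt ℝ (fderiv ℝ F) e := (hFR e he).fderiv
    simp only [m, Matrix.det_apply']
    refine Finset.analyticAt_fun_sum _ fun σ _ => analyticAt_const.mul
      (Finset.analyticAt_fun_prod _ fun i _ => ?_)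
    have hπ : AnalyticAt ℝ (fun v : E' => π v (σ i)) (fderiv ℝ F e (ι (Pi.single i 1))) :=
      ((ContinuousLinearMap.proj (R := ℝ) (σ i)) ∘L π).analyticAt _
    have hev : AnalyticAt ℝ (fun e => fderiv ℝ F e (ι (Pi.single i 1))) e :=
      ((ContinuousLinearMap.apply ℝ E' (ι (Pi.single i 1))).analyticAt _).fun_comp hd
    have := AnalyticAt.fun_comp (g := fun v : E' => π v (σ i))
      (f := fun e => fderiv ℝ F e (ι (Pi.single i 1))) hπ hev
    simpa [LinearMap.toMatrix'_apply, C] using this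
  have hmy : m y ≠ 0 := by
    have : (C y).toLinearMap = LinearMap.id := LinearMap.ext hιπ
    simp [m, this]
  refine measure_mono_null ?_ (measure_zeroSet_ball_eq_zero μ hm hy hmy)
  rintro e ⟨he, hlt⟩
  refine ⟨he, ?_⟩
  by_contra hne
  have hsurj : Function.Surjective (C e) := by
    have hu : IsUnit (LinearMap.toMatrix' (C e).toLinearMap).det := isUnit_iff_ne_zero.2 hne
    rw [LinearMap.det_toMatrix'] at hu
    exact (LinearEquiv.ofIsUnitDet (f := (C e).toLinearMap) (v := Pi.basisFun ℝ _)
      (v' := Pi.basisFun ℝ _) (by rwa [LinearMap.det_toMatrix])).surjective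
  have h1 : clmRank (C e) = r := by
    rw [(clmRank_eq_codomain_iff _).2 hsurj]; simp
  have h2 : clmRank (C e) ≤ clmRank (fderiv ℝ F e) :=
    (clmRank_comp_le_right _ _).trans (clmRank_comp_le_left _ _)
  omega

/-- If a linear map `π` already maps the range of `A` onto a space of dimension at least
`clmRank A`, then `π` is injective on this range. -/
theorem apply_eq_zero_of_comp_surjective [FiniteDimensional ℝ E'] [FiniteDimensional ℝ E'']
    {A : E →L[ℝ] E'} {π : E' →L[ℝ] E''} (hA : clmRank A ≤ finrank ℝ E'')
    (hπ : Function.Surjective (π ∘L A)) {v : E} (hv : π (A v) = 0) : A v = 0 := by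
  let q : LinearMap.range A.toLinearMap →ₗ[ℝ] E'' := π.toLinearMap.domRestrict _
  have hq : Function.Surjective q := fun w => by
    obtain ⟨u, hu⟩ := hπ w
    exact ⟨⟨A u, u, rfl⟩, hu⟩
  have hdim : finrank ℝ (LinearMap.range A.toLinearMap) = finrank ℝ E'' :=
    le_antisymm hA (LinearMap.finrank_le_finrank_of_surjective hq)
  have hinj := (LinearMap.injective_iff_surjective_of_finrank_eq_finrank hdim).2 hq
  have : (⟨A v, v, rfl⟩ : LinearMap.range A.toLinearMap) = 0 := hinj (by simpa [q] using hv)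
  exact congrArg Subtype.val this

/-- The part of the constant rank theorem that is needed: where the rank of the differential of `F`
is locally maximal, hence locally constant, the fibre of `F` contains a graph over the kernel of
the differential. -/
theorem exists_projection_fiber_mem_nhds [FiniteDimensional ℝ E] [FiniteDimensional ℝ E']
    {F : E → E'} {e₀ : E} (hF : ContDiffAt ℝ 1 F e₀)
    (hr : ∀ᶠ e in 𝓝 e₀, clmRank (fderiv ℝ F e) ≤ clmRank (fderiv ℝ F e₀)) :
    ∃ (K : Submodule ℝ E) (P : E →L[ℝ] K), finrank ℝ K + clmRank (fderiv ℝ F e₀) = finrank ℝ E ∧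
      ∀ T ∈ 𝓝 e₀, P '' {e ∈ T | F e = F e₀} ∈ 𝓝 (P e₀) := by
  set A₀ := fderiv ℝ F e₀
  let R := LinearMap.range A₀.toLinearMap
  let K := LinearMap.ker A₀.toLinearMap
  obtain ⟨π', hπ'⟩ := LinearMap.exists_leftInverse_of_injective R.subtype R.ker_subtype
  obtain ⟨P', hP'⟩ := LinearMap.exists_leftInverse_of_injective K.subtype K.ker_subtype
  let π : E' →L[ℝ] R := π'.toContinuousLinearMap
  let P : E →L[ℝ] K := P'.toContinuousLinearMap
  have hdim : finrank ℝ K + clmRank A₀ = finrank ℝ E := by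
    rw [add_comm]; exact A₀.toLinearMap.finrank_range_add_finrank_ker
  refine ⟨K, P, hdim, ?_⟩
  -- the map `Ψ` is a chart which straightens the fibres of `π ∘ F`
  let Ψ : E → R × K := fun e => (π (F e), P e)
  have hΨd : ∀ e, DifferentiableAt ℝ F e →
      HasFDerivAt Ψ ((π ∘L fderiv ℝ F e).prod P) e := fun e he =>
    (π.hasFDerivAt.comp e he.hasFDerivAt).prodMk P.hasFDerivAt
  have hFd : ∀ᶠ e in 𝓝 e₀, DifferentiableAt ℝ F e :=
    (hF.eventually (by simp)).mono fun e he => he.differentiableAt (by simp)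
  have hinj : Function.Injective ((π ∘L A₀).prod P) := by
    refine (injective_iff_map_eq_zero _).2 fun v hv => ?_
    have h1 : π (A₀ v) = 0 := congrArg Prod.fst hv
    have h2 : P v = 0 := congrArg Prod.snd hv
    have h3 : π (A₀ v) = ⟨A₀ v, v, rfl⟩ :=
      LinearMap.congr_fun hπ' (⟨A₀ v, v, rfl⟩ : R)
    have h4 : A₀ v = 0 := congrArg Subtype.val (h3.symm.trans h1)
    have h5 : P v = ⟨v, h4⟩ := LinearMap.congr_fun hP' (⟨v, h4⟩ : K)
    exact congrArg Subtype.val (h5.symm.trans h2)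
  let Λ : E ≃L[ℝ] R × K := (LinearMap.linearEquivOfInjective
    ((π ∘L A₀).prod P).toLinearMap hinj
      (by rw [finrank_prod, ← hdim, add_comm]; rfl)).toContinuousLinearEquiv
  have hΛ : (Λ : E →L[ℝ] R × K) = (π ∘L A₀).prod P := by ext v <;> rfl
  have hΨ1 : ContDiffAt ℝ 1 Ψ e₀ := (π.contDiff.contDiffAt.comp e₀ hF).prodMk P.contDiff.contDiffAt
  have hΨ' : HasFDerivAt Ψ (Λ : E →L[ℝ] R × K) e₀ := by
    rw [hΛ]; exact hΨd e₀ (hF.differentiableAt (by simp))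
  have hΨs : HasStrictFDerivAt Ψ (Λ : E →L[ℝ] R × K) e₀ := hΨ1.hasStrictFDerivAt' hΨ' (by simp)
  -- the rank stays constant near `e₀`
  have hsurj : ∀ᶠ e in 𝓝 e₀, Function.Surjective (π ∘L fderiv ℝ F e) := by
    have hc : ContinuousAt (fderiv ℝ Ψ) e₀ :=
      (hΨ1.fderiv_right (m := 0) (by simp)).continuousAt
    have hmem : range ((↑) : (E ≃L[ℝ] R × K) → E →L[ℝ] R × K) ∈ 𝓝 (fderiv ℝ Ψ e₀) := by
      rw [hΨ'.fderiv]; exact Λ.nhds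
    filter_upwards [hc hmem, hFd] with e he hed w
    obtain ⟨Λ', hΛ'⟩ := he
    rw [(hΨd e hed).fderiv] at hΛ'
    obtain ⟨v, hv⟩ := Λ'.surjective (w, 0)
    refine ⟨v, ?_⟩
    have := congrArg (fun B : E →L[ℝ] R × K => (B v).1) hΛ'
    simp only [ContinuousLinearEquiv.coe_coe, hv] at this
    exact this.symm
  let inv := hΨs.localInverse Ψ Λ e₀
  have hinv1 : ContDiffAt ℝ 1 inv (Ψ e₀) := hΨ1.to_localInverse hΨ' (by simp)
  have hinv0 : inv (Ψ e₀) = e₀ := hΨs.localInverse_apply_image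
  have hinvr : ∀ᶠ z in 𝓝 (Ψ e₀), Ψ (inv z) = z := hΨs.eventually_right_inverse
  let χ : K → E := fun k => inv (π (F e₀), k)
  have hpair : ContDiff ℝ 1 (fun k : K => (π (F e₀), k)) := contDiff_const.prodMk contDiff_id
  have hχ1 : ContDiffAt ℝ 1 χ (P e₀) := hinv1.comp (P e₀) hpair.contDiffAt
  have hχ0 : χ (P e₀) = e₀ := hinv0
  have hχc : Tendsto χ (𝓝 (P e₀)) (𝓝 e₀) := by
    have := hχ1.continuousAt.tendsto; rwa [hχ0] at this
  have hχr : ∀ᶠ k in 𝓝 (P e₀), Ψ (χ k) = (π (F e₀), k) :=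
    (hpair.continuous.tendsto (P e₀)).eventually hinvr
  have hχd : ∀ᶠ k in 𝓝 (P e₀), DifferentiableAt ℝ χ k :=
    (hχ1.eventually (by simp)).mono fun e he => he.differentiableAt (by simp)
  -- `π ∘ F ∘ χ` is constant and `π` is injective on the range of the differential of `F`
  have hzero : ∀ᶠ k in 𝓝 (P e₀), HasFDerivAt (F ∘ χ) (0 : K →L[ℝ] E') k := by
    filter_upwards [hχr.eventually_nhds, hχd, hχc.eventually hFd, hχc.eventually hr,
      hχc.eventually hsurj] with k hk hkd hFk hrk hsk
    have h1 : HasFDerivAt (F ∘ χ) (fderiv ℝ F (χ k) ∘L fderiv ℝ χ k) k :=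
      hFk.hasFDerivAt.comp k hkd.hasFDerivAt
    have h2 : HasFDerivAt (fun k => π (F (χ k))) (π ∘L (fderiv ℝ F (χ k) ∘L fderiv ℝ χ k)) k :=
      π.hasFDerivAt.comp k h1
    have h3 : HasFDerivAt (fun k => π (F (χ k))) (0 : K →L[ℝ] R) k :=
      (hasFDerivAt_const (π (F e₀)) k).congr_of_eventuallyEq
        (hk.mono fun k hk => congrArg Prod.fst hk)
    have h4 := h2.unique h3
    convert h1 using 1
    ext v
    symm
    exact apply_eq_zero_of_comp_surjective (π := π) hrk hsk (DFunLike.congr_fun h4 v)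
  obtain ⟨ε, hε, hball⟩ := Metric.eventually_nhds_iff_ball.1 hzero
  have hconst : ∀ k ∈ ball (P e₀) ε, F (χ k) = F e₀ := by
    intro k hk
    have := isOpen_ball.is_const_of_fderiv_eq_zero (𝕜 := ℝ) (convex_ball (P e₀) ε).isPreconnected
      (fun k hk => (hball k hk).differentiableAt.differentiableWithinAt)
      (fun k hk => (hball k hk).fderiv) hk (mem_ball_self hε)
    simpa [hχ0] using this
  intro T hT
  filter_upwards [ball_mem_nhds (P e₀) hε, hχc hT, hχr] with k hk hkT hkr
  exact ⟨χ k, ⟨hkT, hconst k hk⟩, congrArg Prod.snd hkr⟩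

/-- An analytic map has an analytic local section at a point where its differential is surjective:
the local inverse of its restriction to an affine subspace transverse to the kernel. -/
theorem exists_analytic_section [FiniteDimensional ℝ E] [FiniteDimensional ℝ E']
    {F : E → E'} {e₀ : E} (hF : ContDiffAt ℝ ω F e₀) (hs : Function.Surjective (fderiv ℝ F e₀)) :
    ∃ τ : E' → E, ContDiffAt ℝ ω τ (F e₀) ∧ τ (F e₀) = e₀ ∧ ∀ᶠ q in 𝓝 (F e₀), F (τ q) = q := by
  obtain ⟨R', hR'⟩ := LinearMap.exists_rightInverse_of_surjective (fderiv ℝ F e₀).toLinearMap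
    (LinearMap.range_eq_top.2 hs)
  let R : E' →L[ℝ] E := R'.toContinuousLinearMap
  have hR : ∀ v, fderiv ℝ F e₀ (R v) = v := fun v => LinearMap.congr_fun hR' v
  let ℓ : E' → E := fun v => e₀ + R v
  have hℓ : ContDiff ℝ ω ℓ := contDiff_const.add R.contDiff
  have hℓ0 : ℓ 0 = e₀ := by simp [ℓ]
  have hF' : ContDiffAt ℝ ω F (ℓ 0) := by rwa [hℓ0]
  have hB : ContDiffAt ℝ ω (F ∘ ℓ) 0 := hF'.comp 0 hℓ.contDiffAt
  have hB' : HasFDerivAt (F ∘ ℓ)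
      ((ContinuousLinearEquiv.refl ℝ E' : E' ≃L[ℝ] E') : E' →L[ℝ] E') 0 := by
    have h1 : HasFDerivAt ℓ R 0 := R.hasFDerivAt.const_add e₀
    have h2 : HasFDerivAt F (fderiv ℝ F e₀) (ℓ 0) := by
      rw [hℓ0]; exact (hF.differentiableAt (by simp)).hasFDerivAt
    convert h2.comp 0 h1 using 1
    ext v
    exact (hR v).symm
  have hBs : HasStrictFDerivAt (F ∘ ℓ) _ 0 := hB.hasStrictFDerivAt' hB' (by simp)
  have hval : (F ∘ ℓ) 0 = F e₀ := by simp [hℓ0]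
  refine ⟨ℓ ∘ hBs.localInverse _ _ _, ?_, ?_, ?_⟩
  · rw [← hval]
    exact hℓ.contDiffAt.comp _ (hB.to_localInverse hB' (by simp))
  · rw [← hval, Function.comp_apply, hBs.localInverse_apply_image, hℓ0]
  · rw [← hval]
    exact hBs.eventually_right_inverse

end Rank

/-! ### Finite products of manifolds -/

section Pi

variable {ι : Type*} [Fintype ι] {E : ι → Type*} [∀ i, NormedAddCommGroup (E i)]
  [∀ i, NormedSpace ℝ (E i)] {H : ι → Type*} [∀ i, TopologicalSpace (H i)]
  {I : ∀ i, ModelWithCorners ℝ (E i) (H i)}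
  {M : ι → Type*} [∀ i, TopologicalSpace (M i)] [∀ i, ChartedSpace (H i) (M i)]

theorem boundaryless_pi (hI : ∀ i, (I i).Boundaryless) : (ModelWithCorners.pi I).Boundaryless where
  range_eq_univ := by
    refine range_eq_univ.2 fun v => ?_
    choose w hw using fun i => range_eq_univ.1 (hI i).range_eq_univ (v i)
    exact ⟨w, funext hw⟩

theorem isManifold_pi {n : ℕ∞ω} (hM : ∀ i, IsManifold (I i) n (M i)) :
    IsManifold (ModelWithCorners.pi I) n (∀ i, M i) := by
  refine isManifold_of_contDiffOn _ _ _ ?_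
  rintro _ _ ⟨e, he, rfl⟩ ⟨e', he', rfl⟩
  refine contDiffOn_pi.2 fun i => ?_
  have h1 : ContDiffOn ℝ n (I i ∘ (e i).symm ≫ₕ e' i ∘ (I i).symm)
      ((I i).symm ⁻¹' ((e i).symm ≫ₕ e' i).source ∩ range (I i)) :=
    ((contDiffGroupoid n (I i)).compatible (he i trivial) (he' i trivial)).1
  refine h1.comp (ContinuousLinearMap.proj (R := ℝ) (φ := E) i).contDiff.contDiffOn ?_
  rintro v ⟨⟨hv1, hv2⟩, ⟨w, rfl⟩⟩
  exact ⟨⟨hv1 i trivial, hv2 i trivial⟩, ⟨w i, rfl⟩⟩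

variable {E₀ H₀ X : Type*} [NormedAddCommGroup E₀] [NormedSpace ℝ E₀] [TopologicalSpace H₀]
  {I₀ : ModelWithCorners ℝ E₀ H₀} [TopologicalSpace X] [ChartedSpace H₀ X]

theorem contMDiff_pi {n : ℕ∞ω} {f : X → ∀ i, M i}
    (hf : ∀ i, ContMDiff I₀ (I i) n (fun x => f x i)) :
    ContMDiff I₀ (ModelWithCorners.pi I) n f := by
  intro x
  refine contMDiffAt_iff.2 ⟨continuousAt_pi.2 fun i => (hf i).continuous.continuousAt, ?_⟩
  exact contDiffWithinAt_pi.2 fun i => (contMDiffAt_iff.1 (hf i x)).2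

theorem contMDiff_eval {n : ℕ∞ω} (i : ι) :
    ContMDiff (ModelWithCorners.pi I) (I i) n (fun x : ∀ i, M i => x i) := by
  intro x
  refine contMDiffAt_iff.2 ⟨(continuous_apply i).continuousAt, ?_⟩
  have hproj := (ContinuousLinearMap.proj (R := ℝ) (φ := E) i).contDiff (n := n)
  refine hproj.contDiffWithinAt.congr_of_eventuallyEq_of_mem ?_ ?_
  · have hmem : (extChartAt (ModelWithCorners.pi I) x).target ∈
        𝓝[range (ModelWithCorners.pi I)] (extChartAt (ModelWithCorners.pi I) x x) :=
      extChartAt_target_mem_nhdsWithin x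
    filter_upwards [hmem] with v hv
    have := (extChartAt (ModelWithCorners.pi I) x).right_inv hv
    exact congrFun this i
  · exact mem_range_self _

end Pi

/-! ### Null sets and Hausdorff dimension on manifolds -/

section NullSets

variable {E H X : Type*} [NormedAddCommGroup E] [NormedSpace ℝ E] [MeasureSpace E]
  [TopologicalSpace H] {I : ModelWithCorners ℝ E H} [TopologicalSpace X] [ChartedSpace H X]

theorem IsNullSet.mono {A B : Set X} (hB : IsNullSet I B) (h : A ⊆ B) : IsNullSet I A := fun x =>
  measure_mono_null (image_mono (inter_subset_inter_left _ h)) (hB x)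

theorem IsNullSet.biUnion {ι : Type*} {s : Set ι} (hs : s.Countable) {A : ι → Set X}
    (hA : ∀ i ∈ s, IsNullSet I (A i)) : IsNullSet I (⋃ i ∈ s, A i) := fun x => by
  have : extChartAt I x '' ((⋃ i ∈ s, A i) ∩ (extChartAt I x).source) =
      ⋃ i ∈ s, extChartAt I x '' (A i ∩ (extChartAt I x).source) := by
    simp only [iUnion_inter, image_iUnion]
  rw [this]
  exact (measure_biUnion_null_iff hs).2 fun i hi => hA i hi x

/-- Being a null set is a local property, by the Lindelöf property. -/
theorem isNullSet_of_forall_exists_nhds [SecondCountableTopology X] {A : Set X}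
    (h : ∀ x ∈ A, ∃ W ∈ 𝓝 x, IsNullSet I (A ∩ W)) : IsNullSet I A := by
  choose! W hW hA using h
  obtain ⟨t, htA, htc, hcov⟩ := TopologicalSpace.countable_cover_nhdsWithin
    (f := W) (s := A)
    (fun x hx => mem_nhdsWithin_of_mem_nhds (hW x hx))
  refine (IsNullSet.biUnion htc fun x hx => hA x (htA hx)).mono fun x hx => ?_
  obtain ⟨i, hi, hxi⟩ := mem_iUnion₂.1 (hcov hx)
  exact mem_iUnion₂.2 ⟨i, hi, hx, hxi⟩

theorem not_isNullSet_of_mem_nhds [I.Boundaryless] [(volume : Measure E).IsOpenPosMeasure]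
    {A : Set X} {x : X}
    (hA : A ∈ 𝓝 x) : ¬ IsNullSet I A := fun h => by
  have h1 : A ∩ (extChartAt I x).source ∈ 𝓝 x := inter_mem hA (extChartAt_source_mem_nhds x)
  exact (Measure.measure_pos_of_mem_nhds volume
    (extChartAt_image_nhds_mem_nhds_of_boundaryless h1)).ne' (h x)

variable [FiniteDimensional ℝ E] [BorelSpace E] [(volume : Measure E).IsAddHaarMeasure]
  [IsManifold I 1 X]

/-- To be a null set can be tested in a single chart, since transition maps are differentiable. -/
theorem isNullSet_of_volume_image_eq_zero {A : Set X} {x : X} (hA : A ⊆ (extChartAt I x).source)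
    (h : volume (extChartAt I x '' A) = 0) : IsNullSet I A := fun y => by
  have hsub : extChartAt I y '' (A ∩ (extChartAt I y).source) =
      (extChartAt I y ∘ (extChartAt I x).symm) ''
        (extChartAt I x '' (A ∩ (extChartAt I y).source)) := by
    rw [image_comp]
    congr 1
    rw [← image_comp]
    refine (EqOn.image_eq_self fun z hz => ?_).symm
    exact (extChartAt I x).left_inv (hA hz.1)
  rw [hsub]
  refine addHaar_image_eq_zero_of_differentiableOn_of_addHaar_eq_zero volume ?_
    (measure_mono_null (image_mono inter_subset_left) h)
  have hd : DifferentiableOn ℝ (extChartAt I y ∘ (extChartAt I x).symm)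
      ((extChartAt I x).symm ≫ extChartAt I y).source :=
    (contDiffOn_ext_coord_change (n := 1) y x).differentiableOn (by simp)
  refine hd.mono ?_
  rintro _ ⟨z, ⟨hz, hzy⟩, rfl⟩
  refine ⟨(extChartAt I x).map_source (hA hz), ?_⟩
  have := (extChartAt I x).left_inv (hA hz)
  change (extChartAt I x).symm (extChartAt I x z) ∈ (extChartAt I y).source
  rw [this]
  exact hzy

end NullSets

section HausdorffDimension

/-- The image of a manifold under a `C¹` map has at most the dimension of the manifold. -/
theorem dimH_image_le_finrank_of_contMDiffOn {EG HG G K : Type*} [NormedAddCommGroup EG]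
    [NormedSpace ℝ EG] [FiniteDimensional ℝ EG] [TopologicalSpace HG]
    {IG : ModelWithCorners ℝ EG HG} [IG.Boundaryless] [TopologicalSpace G] [ChartedSpace HG G]
    [SecondCountableTopology G] [NormedAddCommGroup K] [NormedSpace ℝ K]
    {f : G → K} {s : Set G} (hs : IsOpen s) (hf : ContMDiffOn IG 𝓘(ℝ, K) 1 f s) :
    dimH (f '' s) ≤ finrank ℝ EG := by
  have hloc : ∀ γ ∈ s, ∃ t ∈ 𝓝 γ, dimH (f '' t) ≤ finrank ℝ EG := by
    intro γ hγ
    have h1 : ContDiffAt ℝ 1 (f ∘ (extChartAt IG γ).symm) (extChartAt IG γ γ) := by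
      have := (contMDiffAt_iff.1 (hf.contMDiffAt (hs.mem_nhds hγ))).2
      rwa [IG.range_eq_univ, contDiffWithinAt_univ] at this
    obtain ⟨ε, hε, hball⟩ := Metric.eventually_nhds_iff_ball.1 (h1.eventually (by simp))
    refine ⟨(extChartAt IG γ).source ∩ extChartAt IG γ ⁻¹' ball (extChartAt IG γ γ) ε,
      inter_mem (extChartAt_source_mem_nhds γ)
        ((continuousAt_extChartAt γ).preimage_mem_nhds (ball_mem_nhds _ hε)), ?_⟩
    calc dimH (f '' ((extChartAt IG γ).source ∩ extChartAt IG γ ⁻¹' ball (extChartAt IG γ γ) ε))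
        ≤ dimH ((f ∘ (extChartAt IG γ).symm) '' ball (extChartAt IG γ γ) ε) := by
          refine dimH_mono ?_
          rintro _ ⟨z, ⟨hz, hzε⟩, rfl⟩
          exact ⟨extChartAt IG γ z, hzε, congrArg f ((extChartAt IG γ).left_inv hz)⟩
      _ ≤ dimH (ball (extChartAt IG γ γ) ε) :=
          ContDiffOn.dimH_image_le (fun z hz => (hball z hz).contDiffWithinAt)
            (convex_ball _ _) subset_rfl
      _ ≤ finrank ℝ EG := (dimH_mono (subset_univ _)).trans_eq (Real.dimH_univ_eq_finrank EG)
  choose! t ht hdim using hloc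
  obtain ⟨c, hcs, hcc, hcov⟩ := TopologicalSpace.countable_cover_nhdsWithin
    (f := t) (s := s)
    (fun γ hγ => mem_nhdsWithin_of_mem_nhds (ht γ hγ))
  calc dimH (f '' s) ≤ dimH (⋃ γ ∈ c, f '' t γ) := by
        refine dimH_mono ?_
        rw [← image_iUnion₂]
        exact image_mono hcov
    _ = ⨆ γ ∈ c, dimH (f '' t γ) := dimH_bUnion hcc _
    _ ≤ finrank ℝ EG := iSup₂_le fun γ hγ => hdim γ (hcs hγ)

end HausdorffDimension

/-! ### The rank of the differential in charts -/

section Charts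

variable {E E' : Type*} [NormedAddCommGroup E] [NormedSpace ℝ E]
  [NormedAddCommGroup E'] [NormedSpace ℝ E']

theorem clmRank_invertible_comp [FiniteDimensional ℝ E'] {A : E' →L[ℝ] E'}
    (hA : A.IsInvertible) (B : E →L[ℝ] E') :
    clmRank (A ∘L B) = clmRank B := by
  refine le_antisymm (clmRank_comp_le_right _ _) ?_
  obtain ⟨A', rfl⟩ := hA
  conv_lhs => rw [show B = (A'.symm : E' →L[ℝ] E') ∘L ((A' : E' →L[ℝ] E') ∘L B) by ext; simp]
  exact clmRank_comp_le_right _ _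

theorem clmRank_comp_invertible [FiniteDimensional ℝ E'] {A : E →L[ℝ] E}
    (hA : A.IsInvertible) (B : E →L[ℝ] E') :
    clmRank (B ∘L A) = clmRank B := by
  refine le_antisymm (clmRank_comp_le_left _ _) ?_
  obtain ⟨A', rfl⟩ := hA
  conv_lhs => rw [show B = (B ∘L (A' : E →L[ℝ] E)) ∘L (A'.symm : E →L[ℝ] E) by ext; simp]
  exact clmRank_comp_le_left _ _

variable {H H' X Y : Type*} [TopologicalSpace H] [TopologicalSpace H']
  (I : ModelWithCorners ℝ E H) (J : ModelWithCorners ℝ E' H')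
  [TopologicalSpace X] [ChartedSpace H X] [TopologicalSpace Y] [ChartedSpace H' Y]

/-- The rank of the differential of a map between manifolds, as a natural number. The tangent spaces
are identified with the model spaces, to which they are definitionally equal. -/
noncomputable def mfderivRank (F : X → Y) (x : X) : ℕ :=
  clmRank (E := E) (E' := E') (mfderiv I J F x)

variable {I J} [I.Boundaryless] {F : X → Y} {x : X}

theorem mfderiv_eq_fderiv_writtenInExtChartAt (hF : MDifferentiableAt I J F x) :
    mfderiv I J F x = fderiv ℝ (writtenInExtChartAt I J x F) (extChartAt I x x) := by
  refine hF.mfderiv.trans ?_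
  rw [I.range_eq_univ, fderivWithin_univ]

theorem contDiffAt_writtenInExtChartAt {n : ℕ∞ω} (hF : ContMDiffAt I J n F x) :
    ContDiffAt ℝ n (writtenInExtChartAt I J x F) (extChartAt I x x) := by
  have := (contMDiffAt_iff.1 hF).2
  rwa [I.range_eq_univ, contDiffWithinAt_univ] at this

variable [FiniteDimensional ℝ E'] [IsManifold I 1 X] [IsManifold J 1 Y]

theorem mfderivRank_eq_clmRank_fderiv {y : X} (hy : y ∈ (extChartAt I x).source)
    (hFy : F y ∈ (extChartAt J (F x)).source) (hF : MDifferentiableAt I J F y) :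
    mfderivRank I J F y =
      clmRank (fderiv ℝ (writtenInExtChartAt I J x F) (extChartAt I x y)) := by
  have he : extChartAt I x y ∈ (extChartAt I x).target := (extChartAt I x).map_source hy
  have hey : (extChartAt I x).symm (extChartAt I x y) = y := (extChartAt I x).left_inv hy
  generalize extChartAt I x y = e at he hey ⊢
  subst hey
  have hA : HasMFDerivAt J 𝓘(ℝ, E') (extChartAt J (F x)) (F ((extChartAt I x).symm e))
      (mfderiv J 𝓘(ℝ, E') (extChartAt J (F x)) (F ((extChartAt I x).symm e))) :=
    (mdifferentiableAt_extChartAt (by simpa using hFy)).hasMFDerivAt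
  have hC : HasMFDerivAt 𝓘(ℝ, E) I (extChartAt I x).symm e
      (mfderiv 𝓘(ℝ, E) I (extChartAt I x).symm e) := by
    have := mdifferentiableWithinAt_extChartAt_symm he
    rw [I.range_eq_univ, mdifferentiableWithinAt_univ] at this
    exact this.hasMFDerivAt
  let A : E' →L[ℝ] E' := mfderiv J 𝓘(ℝ, E') (extChartAt J (F x)) (F ((extChartAt I x).symm e))
  let B : E →L[ℝ] E' := mfderiv I J F ((extChartAt I x).symm e)
  let C : E →L[ℝ] E := mfderiv 𝓘(ℝ, E) I (extChartAt I x).symm e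
  have hAi : A.IsInvertible := isInvertible_mfderiv_extChartAt hFy
  have hCi : C.IsInvertible := by
    have := isInvertible_mfderivWithin_extChartAt_symm he
    rw [I.range_eq_univ, mfderivWithin_univ] at this
    exact this
  have hcomp : HasMFDerivAt 𝓘(ℝ, E) 𝓘(ℝ, E') (writtenInExtChartAt I J x F) e (A ∘L (B ∘L C)) :=
    hA.comp e (hF.hasMFDerivAt.comp e hC)
  have hfd : HasFDerivAt (writtenInExtChartAt I J x F) (A ∘L (B ∘L C)) e :=
    hasMFDerivAt_iff_hasFDerivAt.1 hcomp
  rw [hfd.fderiv, clmRank_invertible_comp hAi, clmRank_comp_invertible hCi]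
  rfl

end Charts

/-! ### Genericity of the rank on manifolds -/

section GenericRank

variable {E E' H H' X Y : Type*} [NormedAddCommGroup E] [NormedSpace ℝ E]
  [NormedAddCommGroup E'] [NormedSpace ℝ E'] [FiniteDimensional ℝ E']
  [TopologicalSpace H] [TopologicalSpace H']
  {I : ModelWithCorners ℝ E H} {J : ModelWithCorners ℝ E' H'} [I.Boundaryless]
  [TopologicalSpace X] [ChartedSpace H X] [TopologicalSpace Y] [ChartedSpace H' Y]
  [IsManifold I 1 X] [IsManifold J 1 Y] {F : X → Y} {U : Set X}

theorem eventually_mfderivRank_eq (hU : IsOpen U) (hF : ContMDiffOn I J 1 F U) {x : X}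
    (hx : x ∈ U) : ∀ᶠ y in 𝓝 x, mfderivRank I J F y =
      clmRank (fderiv ℝ (writtenInExtChartAt I J x F) (extChartAt I x y)) := by
  have hFx : ContinuousAt F x := (hF.contMDiffAt (hU.mem_nhds hx)).continuousAt
  filter_upwards [hU.mem_nhds hx, extChartAt_source_mem_nhds (I := I) x,
    hFx.preimage_mem_nhds (extChartAt_source_mem_nhds (I := J) (F x))] with y hyU hy hFy
  exact mfderivRank_eq_clmRank_fderiv hy hFy
    ((hF.contMDiffAt (hU.mem_nhds hyU)).mdifferentiableAt (by simp))

variable [FiniteDimensional ℝ E] [MeasureSpace E] [BorelSpace E]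
  [(volume : Measure E).IsAddHaarMeasure]

/-- Every point of `U` has a neighbourhood on which the rank of the differential has a maximal value
and takes it almost everywhere. -/
theorem exists_nhds_generic_mfderivRank (hU : IsOpen U) (hF : ContMDiffOn I J ω F U) {x : X}
    (hx : x ∈ U) : ∃ W ∈ 𝓝 x, ∃ r : ℕ, (∀ y ∈ W, mfderivRank I J F y ≤ r) ∧
      IsNullSet I {y ∈ W | mfderivRank I J F y < r} := by
  have han : AnalyticAt ℝ (writtenInExtChartAt I J x F) (extChartAt I x x) :=
    ContDiffAt.analyticAt
      (contDiffAt_writtenInExtChartAt (hF.contMDiffAt (hU.mem_nhds hx)))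
  obtain ⟨r, ρ, hρ, hle, hnull⟩ := exists_generic_rank (volume : Measure E) han
  refine ⟨{y | (y ∈ (extChartAt I x).source ∧ extChartAt I x y ∈ ball (extChartAt I x x) ρ) ∧
    mfderivRank I J F y = clmRank (fderiv ℝ (writtenInExtChartAt I J x F) (extChartAt I x y))},
    ?_, r, ?_, ?_⟩
  · exact inter_mem (inter_mem (extChartAt_source_mem_nhds x)
      ((continuousAt_extChartAt x).preimage_mem_nhds (ball_mem_nhds _ hρ)))
      (eventually_mfderivRank_eq hU (hF.of_le (by simp)) hx)
  · rintro y ⟨⟨-, hy⟩, hr⟩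
    rw [hr]
    exact hle _ hy
  · refine isNullSet_of_volume_image_eq_zero (x := x) (fun y hy => hy.1.1.1)
      (measure_mono_null ?_ hnull)
    rintro _ ⟨y, ⟨⟨⟨-, hy⟩, hr⟩, hlt⟩, rfl⟩
    exact ⟨hy, hr ▸ hlt⟩

theorem isNullSet_not_eventually_mfderivRank_le [SecondCountableTopology X] (hU : IsOpen U)
    (hF : ContMDiffOn I J ω F U) :
    IsNullSet I {x ∈ U | ¬ ∀ᶠ y in 𝓝 x, mfderivRank I J F y ≤ mfderivRank I J F x} := by
  refine isNullSet_of_forall_exists_nhds fun x hx => ?_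
  obtain ⟨W, hW, r, hle, hnull⟩ := exists_nhds_generic_mfderivRank hU hF hx.1
  refine ⟨interior W, interior_mem_nhds.2 hW, hnull.mono ?_⟩
  rintro y ⟨⟨-, hy⟩, hyW⟩
  refine ⟨interior_subset hyW, lt_of_not_ge fun hge => hy ?_⟩
  filter_upwards [mem_interior_iff_mem_nhds.1 hyW] with z hz
  exact (hle z hz).trans hge

/-- On a preconnected set, the points where the differential is not surjective form a null set, as
soon as it is surjective at a single point: the points around which it is surjective almost
everywhere, and those around which it is nowhere surjective, form two disjoint open sets. -/
theorem isNullSet_mfderivRank_lt [SecondCountableTopology X] (hU : IsOpen U)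
    (hF : ContMDiffOn I J ω F U) {C : Set X} (hC : IsPreconnected C) (hCU : C ⊆ U) {x₀ : X}
    (hx₀ : x₀ ∈ C) (hr : mfderivRank I J F x₀ = finrank ℝ E') :
    IsNullSet I {x ∈ C | mfderivRank I J F x < finrank ℝ E'} := by
  let A : Set X := {x | ∃ W ∈ 𝓝 x, IsNullSet I {y ∈ W | mfderivRank I J F y < finrank ℝ E'}}
  let B : Set X := {x | ∃ W ∈ 𝓝 x, ∀ y ∈ W, mfderivRank I J F y < finrank ℝ E'}
  have hA : IsOpen A := isOpen_iff_mem_nhds.2 fun x ⟨W, hW, hN⟩ => by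
    filter_upwards [eventually_mem_nhds_iff.2 hW] with y hy
    exact ⟨W, hy, hN⟩
  have hB : IsOpen B := isOpen_iff_mem_nhds.2 fun x ⟨W, hW, hN⟩ => by
    filter_upwards [eventually_mem_nhds_iff.2 hW] with y hy
    exact ⟨W, hy, hN⟩
  have hAB : C ⊆ A ∪ B := fun x hx => by
    obtain ⟨W, hW, r, hle, hnull⟩ := exists_nhds_generic_mfderivRank hU hF (hCU hx)
    rcases lt_or_ge r (finrank ℝ E') with hlt | hge
    · exact Or.inr ⟨W, hW, fun y hy => (hle y hy).trans_lt hlt⟩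
    · exact Or.inl ⟨W, hW, hnull.mono fun y hy => ⟨hy.1, hy.2.trans_le hge⟩⟩
  have hdisj : Disjoint A B := Set.disjoint_left.2 fun x ⟨W, hW, hN⟩ ⟨W', hW', hlt⟩ =>
    not_isNullSet_of_mem_nhds (inter_mem hW hW')
      (hN.mono fun y hy => ⟨hy.1, hlt y hy.2⟩)
  have hx₀A : x₀ ∈ A := (hAB hx₀).resolve_right fun ⟨W, hW, hlt⟩ =>
    (hlt x₀ (mem_of_mem_nhds hW)).ne hr
  have hCA : C ⊆ A := hC.subset_left_of_subset_union hA hB hdisj hAB ⟨x₀, hx₀, hx₀A⟩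
  refine isNullSet_of_forall_exists_nhds fun x hx => ?_
  obtain ⟨W, hW, hN⟩ := hCA hx.1
  exact ⟨W, hW, hN.mono fun y hy => ⟨hy.2, hy.1.2⟩⟩

end GenericRank

/-! ### Orbits and slices of a smooth action -/

section Action

variable {EG E E' HG H H' G X Y : Type*}
  [NormedAddCommGroup EG] [NormedSpace ℝ EG] [NormedAddCommGroup E] [NormedSpace ℝ E]
  [NormedAddCommGroup E'] [NormedSpace ℝ E']
  [TopologicalSpace HG] [TopologicalSpace H] [TopologicalSpace H']
  {IG : ModelWithCorners ℝ EG HG} {I : ModelWithCorners ℝ E H} {J : ModelWithCorners ℝ E' H'}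
  [TopologicalSpace G] [ChartedSpace HG G] [Group G]
  [TopologicalSpace X] [ChartedSpace H X] [TopologicalSpace Y] [ChartedSpace H' Y]
  [MulAction G X] {F : X → Y} {U : Set X}

theorem contMDiff_smul_const {n : ℕ∞ω}
    (hact : ContMDiff (IG.prod I) I n (fun p : G × X => p.1 • p.2)) (x : X) :
    ContMDiff IG I n (fun γ : G => γ • x) :=
  hact.comp (contMDiff_id.prodMk contMDiff_const)

theorem contMDiff_smul_left {n : ℕ∞ω}
    (hact : ContMDiff (IG.prod I) I n (fun p : G × X => p.1 • p.2)) (γ : G) :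
    ContMDiff I I n (fun x : X => γ • x) :=
  hact.comp (contMDiff_const.prodMk contMDiff_id)

variable [IG.Boundaryless]

/-- The tangent space of the orbit, computed in the chart around `x`. The definition uses the chart
around `1 • x`, which is the same up to a rewrite. -/
theorem mem_orbitTangent_iff (hact : ContMDiff (IG.prod I) I 1 (fun p : G × X => p.1 • p.2))
    (x : X) (v : E) : v ∈ (orbitTangent IG I G x : Submodule ℝ E) ↔
      ∃ u : EG, fderiv ℝ (fun u => extChartAt I x ((extChartAt IG (1 : G)).symm u • x))
        (extChartAt IG (1 : G) 1) u = v := by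
  have h := mfderiv_eq_fderiv_writtenInExtChartAt (I := IG) (J := I)
    (((contMDiff_smul_const hact x) 1).mdifferentiableAt (by simp))
  have hw : writtenInExtChartAt IG I (1 : G) (fun γ : G => γ • x) =
      fun u => extChartAt I x ((extChartAt IG (1 : G)).symm u • x) := by
    funext u
    simp only [writtenInExtChartAt, one_smul, Function.comp_apply]
  rw [hw] at h
  constructor
  · rintro ⟨u, hu⟩
    exact ⟨u, (DFunLike.congr_fun h.symm u).trans hu⟩
  · rintro ⟨u, hu⟩
    exact ⟨u, (DFunLike.congr_fun h u).trans hu⟩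

/-- At a locally recoverable point of locally maximal rank, a piece of the orbit contains a graph in
the fibre, so that its dimension cannot be too small. -/
theorem finrank_le_of_locallyRecoverableAt [I.Boundaryless] [FiniteDimensional ℝ EG]
    [FiniteDimensional ℝ E] [FiniteDimensional ℝ E'] [IsManifold I 1 X] [IsManifold J 1 Y]
    [SecondCountableTopology G]
    (hact : ContMDiff (IG.prod I) I 1 (fun p : G × X => p.1 • p.2))
    (hU : IsOpen U) (hF : ContMDiffOn I J 1 F U) {x : X} (hx : x ∈ U)
    (hmax : ∀ᶠ y in 𝓝 x, mfderivRank I J F y ≤ mfderivRank I J F x)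
    (hrec : LocallyRecoverableAt G F x) : finrank ℝ E ≤ finrank ℝ E' + finrank ℝ EG := by
  obtain ⟨W, hW, hWorb⟩ := hrec
  have hFx := hF.contMDiffAt (hU.mem_nhds hx)
  set φ := extChartAt I x with hφ
  have hφs : Tendsto φ.symm (𝓝 (φ x)) (𝓝 x) := by
    have := continuousAt_extChartAt_symm (I := I) x
    rwa [ContinuousAt, extChartAt_to_inv] at this
  have hrk := eventually_mfderivRank_eq hU hF hx
  have htgt : φ.target ∈ 𝓝 (φ x) := extChartAt_target_mem_nhds x
  have hr : ∀ᶠ e in 𝓝 (φ x), clmRank (fderiv ℝ (writtenInExtChartAt I J x F) e) ≤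
      clmRank (fderiv ℝ (writtenInExtChartAt I J x F) (φ x)) := by
    filter_upwards [hφs.eventually hmax, hφs.eventually hrk, htgt] with e h1 h2 h3
    rw [← hφ, φ.right_inv h3] at h2
    rw [← h2, ← hrk.self_of_nhds]
    exact h1
  obtain ⟨K, P, hdim, hP⟩ := exists_projection_fiber_mem_nhds
    (contDiffAt_writtenInExtChartAt hFx) hr
  have hT : {e | e ∈ φ.target ∧ φ.symm e ∈ W ∧
      F (φ.symm e) ∈ (extChartAt J (F x)).source} ∈ 𝓝 (φ x) :=
    inter_mem htgt (inter_mem (hφs hW) (hφs (hFx.continuousAt.preimage_mem_nhds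
      (extChartAt_source_mem_nhds (I := J) (F x)))))
  have himg := hP _ hT
  have ho : ContMDiff IG I 1 (fun γ : G => γ • x) := contMDiff_smul_const hact x
  have hs : IsOpen {γ : G | γ • x ∈ φ.source} :=
    (isOpen_extChartAt_source x).preimage ho.continuous
  have hf : ContMDiffOn IG 𝓘(ℝ, K) 1 (fun γ : G => P (φ (γ • x))) {γ : G | γ • x ∈ φ.source} := by
    have h1 : ContMDiffOn I 𝓘(ℝ, E) 1 φ φ.source := by
      rw [hφ, extChartAt_source]
      exact contMDiffOn_extChartAt
    have h2 : ContMDiff 𝓘(ℝ, E) 𝓘(ℝ, K) 1 P := P.contDiff.contMDiff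
    exact h2.comp_contMDiffOn (h1.comp ho.contMDiffOn fun γ hγ => hγ)
  have hle := dimH_image_le_finrank_of_contMDiffOn hs hf
  have hsub : P '' {e ∈ {e | e ∈ φ.target ∧ φ.symm e ∈ W ∧
      F (φ.symm e) ∈ (extChartAt J (F x)).source} |
        writtenInExtChartAt I J x F e = writtenInExtChartAt I J x F (φ x)} ⊆
      (fun γ : G => P (φ (γ • x))) '' {γ : G | γ • x ∈ φ.source} := by
    rintro _ ⟨e, ⟨⟨he, heW, heF⟩, heq⟩, rfl⟩
    have hFe : F (φ.symm e) = F x := by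
      refine (extChartAt J (F x)).injOn heF (mem_extChartAt_source _) ?_
      have h2 : extChartAt J (F x) (F (φ.symm e)) = extChartAt J (F x) (F (φ.symm (φ x))) := heq
      rwa [extChartAt_to_inv] at h2
    obtain ⟨γ, hγ⟩ := hWorb _ heW hFe
    have hγ' : γ • x = φ.symm e := hγ
    refine ⟨γ, ?_, ?_⟩
    · change γ • x ∈ φ.source
      rw [hγ']; exact φ.map_target he
    · simp only [hγ', φ.right_inv he]
  have hK : finrank ℝ K ≤ finrank ℝ EG := by
    have := (Real.dimH_of_mem_nhds himg).symm.le.trans ((dimH_mono hsub).trans hle)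
    exact_mod_cast this
  have := clmRank_le_codomain (fderiv ℝ (writtenInExtChartAt I J x F) (φ x))
  rw [← hφ] at hdim
  omega

/-- A slice for the action: a parametrized submanifold through `x`, whose tangent space together
with that of the orbit spans everything, meets the orbits of all points near `x`. -/
theorem setOf_smul_slice_mem_nhds [I.Boundaryless] [CompleteSpace EG]
    [CompleteSpace E] [CompleteSpace E'] [IsManifold I 1 X] [IsManifold IG 1 G]
    (hact : ContMDiff (IG.prod I) I 1 (fun p : G × X => p.1 • p.2)) {x : X}
    {τ : E' → E} {q₀ : E'} (hτ : ContDiffAt ℝ 1 τ q₀) (hτ₀ : τ q₀ = extChartAt I x x)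
    (hspan : ∀ v : E, ∃ o : E, o ∈ (orbitTangent IG I G x : Submodule ℝ E) ∧ ∃ w : E',
      o + fderiv ℝ τ q₀ w = v) {N : Set E'} (hN : N ∈ 𝓝 q₀) :
    {y | ∃ γ : G, ∃ q ∈ N, y = γ • (extChartAt I x).symm (τ q)} ∈ 𝓝 x := by
  set φ := extChartAt I x with hφ
  set κ := extChartAt IG (1 : G) with hκ
  let b : EG × E' → X := fun p => κ.symm p.1 • φ.symm (τ p.2)
  let p₀ : EG × E' := (κ 1, q₀)
  have hκ1 : κ.symm (κ 1) = 1 := extChartAt_to_inv 1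
  have hφx : φ.symm (φ x) = x := extChartAt_to_inv x
  have hb₀ : b p₀ = x := by simp only [b, p₀, hκ1, hτ₀, hφx, one_smul]
  have hb : ContMDiffAt 𝓘(ℝ, EG × E') I 1 b p₀ := by
    have h1 : ContMDiffAt 𝓘(ℝ, EG × E') IG 1 (fun p : EG × E' => κ.symm p.1) p₀ := by
      have : ContMDiffAt 𝓘(ℝ, EG) IG 1 κ.symm (κ 1) :=
        (contMDiffOn_extChartAt_symm (1 : G)).contMDiffAt (extChartAt_target_mem_nhds 1)
      exact this.comp p₀ contDiff_fst.contMDiff.contMDiffAt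
    have h2 : ContMDiffAt 𝓘(ℝ, EG × E') I 1 (fun p : EG × E' => φ.symm (τ p.2)) p₀ := by
      have h3 : ContMDiffAt 𝓘(ℝ, E) I 1 φ.symm (τ q₀) := by
        rw [hτ₀]
        exact (contMDiffOn_extChartAt_symm x).contMDiffAt (extChartAt_target_mem_nhds x)
      have h4 : ContMDiffAt 𝓘(ℝ, EG × E') 𝓘(ℝ, E) 1 (fun p : EG × E' => τ p.2) p₀ :=
        hτ.contMDiffAt.comp p₀ contDiff_snd.contMDiff.contMDiffAt
      exact ContMDiffAt.comp (g := φ.symm) p₀ h3 h4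
    exact (hact (κ.symm p₀.1, φ.symm (τ p₀.2))).comp p₀ (h1.prodMk h2)
  have ha : ContDiffAt ℝ 1 (φ ∘ b) p₀ := by
    refine contMDiffAt_iff_contDiffAt.1 (ContMDiffAt.comp p₀ ?_ hb)
    rw [hb₀]
    exact contMDiffAt_extChartAt
  have ha₀ : (φ ∘ b) p₀ = φ x := congrArg φ hb₀
  have haD : HasStrictFDerivAt (φ ∘ b) (fderiv ℝ (φ ∘ b) p₀) p₀ :=
    ha.hasStrictFDerivAt (by simp)
  -- the partial derivatives of `(u, q) ↦ κ.symm u • φ.symm (τ q)` in the chart `φ`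
  have hfst : HasFDerivAt (fun u => φ (κ.symm u • x))
      (fderiv ℝ (φ ∘ b) p₀ ∘L ContinuousLinearMap.inl ℝ EG E') (κ 1) := by
    have h1 : HasFDerivAt (fun u : EG => (u, q₀)) (ContinuousLinearMap.inl ℝ EG E') (κ 1) :=
      (hasFDerivAt_id (κ 1)).prodMk (hasFDerivAt_const q₀ _)
    have h2 := HasFDerivAt.comp (κ 1) (f := fun u : EG => (u, q₀)) haD.hasFDerivAt h1
    refine h2.congr_of_eventuallyEq (Eventually.of_forall fun u => ?_)
    simp only [b, Function.comp_apply, hτ₀, hφx]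
  have hsnd : HasFDerivAt τ
      (fderiv ℝ (φ ∘ b) p₀ ∘L ContinuousLinearMap.inr ℝ EG E') q₀ := by
    have h1 : HasFDerivAt (fun q : E' => (κ 1, q)) (ContinuousLinearMap.inr ℝ EG E') q₀ :=
      (hasFDerivAt_const (κ 1) _).prodMk (hasFDerivAt_id q₀)
    have h2 := HasFDerivAt.comp q₀ (f := fun q : E' => (κ 1, q)) haD.hasFDerivAt h1
    refine h2.congr_of_eventuallyEq ?_
    have htgt : φ.target ∈ 𝓝 (τ q₀) := by rw [hτ₀]; exact extChartAt_target_mem_nhds x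
    filter_upwards [hτ.continuousAt.preimage_mem_nhds htgt] with q hq
    simp only [b, Function.comp_apply, hκ1, one_smul]
    exact (φ.right_inv hq).symm
  have hsurj : LinearMap.range (fderiv ℝ (φ ∘ b) p₀).toLinearMap = ⊤ := by
    refine LinearMap.range_eq_top.2 fun v => ?_
    obtain ⟨o, ho, w, hv⟩ := hspan v
    obtain ⟨u, hu⟩ := (mem_orbitTangent_iff hact x o).1 ho
    rw [hsnd.fderiv] at hv
    rw [← hκ, ← hφ, hfst.fderiv] at hu
    refine ⟨(u, w), ?_⟩
    have : ((u, w) : EG × E') = (u, 0) + (0, w) := by simp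
    rw [this, map_add, ← hv, ← hu]
    rfl
  have hopen := haD.map_nhds_eq_of_surj hsurj
  rw [ha₀] at hopen
  have hN' : {p : EG × E' | p.2 ∈ N ∧ b p ∈ φ.source} ∈ 𝓝 p₀ := by
    have h1 : ∀ᶠ p : EG × E' in 𝓝 p₀, p.2 ∈ N := continuous_snd.continuousAt.preimage_mem_nhds hN
    have h2 : ∀ᶠ p : EG × E' in 𝓝 p₀, b p ∈ φ.source :=
      hb.continuousAt.preimage_mem_nhds (by rw [hb₀]; exact extChartAt_source_mem_nhds x)
    exact h1.and h2
  have himg : (φ ∘ b) '' {p : EG × E' | p.2 ∈ N ∧ b p ∈ φ.source} ∈ 𝓝 (φ x) := by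
    rw [← hopen]; exact image_mem_map hN'
  filter_upwards [(continuousAt_extChartAt x).preimage_mem_nhds himg,
    extChartAt_source_mem_nhds (I := I) x] with y hy hys
  obtain ⟨p, ⟨hpN, hps⟩, hpy⟩ := hy
  exact ⟨κ.symm p.1, p.2, hpN, (φ.injOn hps hys hpy).symm⟩

end Action

/-! ### Maps invariant under the action -/

section Invariant

variable {EG E E' HG H H' G X Y : Type*}
  [NormedAddCommGroup EG] [NormedSpace ℝ EG] [NormedAddCommGroup E] [NormedSpace ℝ E]
  [NormedAddCommGroup E'] [NormedSpace ℝ E']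
  [TopologicalSpace HG] [TopologicalSpace H] [TopologicalSpace H']
  {IG : ModelWithCorners ℝ EG HG} {I : ModelWithCorners ℝ E H} {J : ModelWithCorners ℝ E' H'}
  [TopologicalSpace G] [ChartedSpace HG G] [Group G]
  [TopologicalSpace X] [ChartedSpace H X] [TopologicalSpace Y] [ChartedSpace H' Y]
  [MulAction G X] {F : X → Y} {U : Set X}

/-- The rank of an invariant map does not decrease along an orbit, by the chain rule applied to
`F ∘ (γ • ·) = F`. -/
theorem mfderivRank_le_smul [FiniteDimensional ℝ E']
    (hact : ContMDiff (IG.prod I) I 1 (fun p : G × X => p.1 • p.2))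
    (hinv : ∀ (γ : G) (x : X), F (γ • x) = F x) {γ : G} {z : X}
    (hF : MDifferentiableAt I J F (γ • z)) :
    mfderivRank I J F z ≤ mfderivRank I J F (γ • z) := by
  have hγ : MDifferentiableAt I I (fun x : X => γ • x) z :=
    ((contMDiff_smul_left hact γ) z).mdifferentiableAt (by simp)
  have hcomp : F ∘ (fun x : X => γ • x) = F := funext fun x => hinv γ x
  let A : E →L[ℝ] E' := mfderiv I J F (γ • z)
  let B : E →L[ℝ] E := mfderiv I I (fun x : X => γ • x) z
  have h : HasMFDerivAt I J (F ∘ (fun x : X => γ • x)) z (A ∘L B) :=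
    HasMFDerivAt.comp z hF.hasMFDerivAt hγ.hasMFDerivAt
  rw [hcomp] at h
  have h' : (mfderiv I J F z : E →L[ℝ] E') = A ∘L B := h.mfderiv
  calc mfderivRank I J F z = clmRank (A ∘L B) := congrArg clmRank h'
    _ ≤ clmRank A := clmRank_comp_le_left _ _

/-- An invariant map is constant on orbits, so its differential vanishes along them. -/
theorem mfderiv_eq_zero_of_mem_orbitTangent
    (hact : ContMDiff (IG.prod I) I 1 (fun p : G × X => p.1 • p.2))
    (hinv : ∀ (γ : G) (x : X), F (γ • x) = F x) {x : X} (hF : MDifferentiableAt I J F x) {v : E}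
    (hv : v ∈ (orbitTangent IG I G x : Submodule ℝ E)) : (mfderiv I J F x : E →L[ℝ] E') v = 0 := by
  obtain ⟨u, hu⟩ := hv
  have ho : MDifferentiableAt IG I (fun γ : G => γ • x) 1 :=
    ((contMDiff_smul_const hact x) 1).mdifferentiableAt (by simp)
  have hF1 : HasMFDerivAt I J F ((1 : G) • x) (mfderiv I J F ((1 : G) • x)) := by
    rw [one_smul]; exact hF.hasMFDerivAt
  have hconst : F ∘ (fun γ : G => γ • x) = fun _ => F x := funext fun γ => hinv γ x
  let A : EG →L[ℝ] E := mfderiv IG I (fun γ : G => γ • x) 1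
  let B : X → (E →L[ℝ] E') := fun y => mfderiv I J F y
  have h : HasMFDerivAt IG J (F ∘ (fun γ : G => γ • x)) 1 (B ((1 : G) • x) ∘L A) :=
    HasMFDerivAt.comp 1 hF1 ho.hasMFDerivAt
  rw [hconst] at h
  have h0 : B ((1 : G) • x) ∘L A = 0 := h.mfderiv.symm.trans mfderiv_const
  rw [one_smul] at h0
  have := DFunLike.congr_fun h0 u
  change B x v = 0
  rw [← hu]
  exact this

theorem mfderivRank_eq_and_finrank_eq_of_jacobianDetNeZero [FiniteDimensional ℝ E]
    [FiniteDimensional ℝ E'] {x : X} (h : JacobianDetNeZero IG I J G F x) :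
    mfderivRank I J F x = finrank ℝ E' ∧
      orbitDim IG I G x + finrank ℝ E' = finrank ℝ E := by
  obtain ⟨L, hL, r, b, b', hdet⟩ := h
  have hbij := (LinearEquiv.ofIsUnitDet (isUnit_iff_ne_zero.2 hdet)).bijective
  have hLs : Function.Surjective L := hbij.2
  constructor
  · refine (clmRank_eq_codomain_iff (E := E) (E' := E') _).2 fun w => ?_
    obtain ⟨q, hq⟩ := hLs w
    obtain ⟨v, rfl⟩ := (orbitTangent IG I G x).mkQ_surjective q
    exact ⟨v, (LinearMap.congr_fun hL v).symm.trans hq⟩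
  · have h1 : finrank ℝ (TangentSpace I x ⧸ orbitTangent IG I G x) = r := by
      rw [finrank_eq_card_basis b, Fintype.card_fin]
    have h2 : finrank ℝ E' = r := by
      have : finrank ℝ (TangentSpace J (F x)) = r := by
        rw [finrank_eq_card_basis b', Fintype.card_fin]
      exact this
    let O : Submodule ℝ E := orbitTangent IG I G x
    have h3 := Submodule.finrank_quotient_add_finrank O
    have h4 : finrank ℝ (E ⧸ O) = r := h1
    have h5 : orbitDim IG I G x = finrank ℝ O := rfl
    omega

/-- Where the differential of an invariant map is surjective and its kernel has the dimension of
the orbit, the kernel consists of the directions along the orbit. -/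
theorem mem_orbitTangent_of_mfderiv_eq_zero [FiniteDimensional ℝ E] [FiniteDimensional ℝ E']
    (hact : ContMDiff (IG.prod I) I 1 (fun p : G × X => p.1 • p.2))
    (hinv : ∀ (γ : G) (x : X), F (γ • x) = F x) {x : X} (hF : MDifferentiableAt I J F x)
    (hr : mfderivRank I J F x = finrank ℝ E')
    (hdim : orbitDim IG I G x + finrank ℝ E' = finrank ℝ E) {v : E}
    (hv : (mfderiv I J F x : E →L[ℝ] E') v = 0) :
    v ∈ (orbitTangent IG I G x : Submodule ℝ E) := by
  let D : E →L[ℝ] E' := mfderiv I J F x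
  let O : Submodule ℝ E := orbitTangent IG I G x
  have hle : O ≤ LinearMap.ker D.toLinearMap :=
    fun w hw => mfderiv_eq_zero_of_mem_orbitTangent hact hinv hF hw
  have h1 : clmRank D + finrank ℝ (LinearMap.ker D.toLinearMap) = finrank ℝ E :=
    D.toLinearMap.finrank_range_add_finrank_ker
  have h2 : clmRank D = finrank ℝ E' := hr
  have h3 : orbitDim IG I G x = finrank ℝ O := rfl
  have hO : O = LinearMap.ker D.toLinearMap := Submodule.eq_of_le_of_finrank_eq hle (by omega)
  have hvD : v ∈ LinearMap.ker D.toLinearMap := hv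
  rw [← hO] at hvD
  exact hvD

variable [IG.Boundaryless] [I.Boundaryless] [FiniteDimensional ℝ EG]
  [FiniteDimensional ℝ E] [FiniteDimensional ℝ E'] [IsManifold IG 1 G]

/-- A local section of `F` exists by the implicit function theorem. Its image is a slice for the
action, so that it meets the orbit of every point near `x`. -/
theorem locallyUniquelyInvertibleAt_of_mfderivRank_eq [J.Boundaryless]
    [IsManifold I ω X] [IsManifold J ω Y]
    (hact : ContMDiff (IG.prod I) I 1 (fun p : G × X => p.1 • p.2))
    (hinv : ∀ (γ : G) (x : X), F (γ • x) = F x) (hU : IsOpen U) (hF : ContMDiffOn I J ω F U)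
    {x : X} (hx : x ∈ U) (hr : mfderivRank I J F x = finrank ℝ E')
    (hdim : orbitDim IG I G x + finrank ℝ E' = finrank ℝ E) :
    LocallyUniquelyInvertibleAt I J G F x := by
  have : IsManifold I 1 X := .of_le (n := ω) (by simp)
  have hFx := hF.contMDiffAt (hU.mem_nhds hx)
  have hFd : MDifferentiableAt I J F x := hFx.mdifferentiableAt (by simp)
  have hD := mfderiv_eq_fderiv_writtenInExtChartAt hFd
  have hFl := contDiffAt_writtenInExtChartAt hFx
  have hsurj : Function.Surjective
      (fderiv ℝ (writtenInExtChartAt I J x F) (extChartAt I x x)) := by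
    have := (clmRank_eq_codomain_iff (E := E) (E' := E') _).1 hr
    intro w
    obtain ⟨v, hv⟩ := this w
    exact ⟨v, (DFunLike.congr_fun hD.symm v).trans hv⟩
  obtain ⟨τ, hτω, hτ₀, hFτ⟩ := exists_analytic_section hFl hsurj
  set φ := extChartAt I x with hφ
  set ψ := extChartAt J (F x) with hψ
  set q₀ := ψ (F x) with hq₀
  have hφx : φ.symm (φ x) = x := extChartAt_to_inv x
  have hψx : ψ.symm q₀ = F x := extChartAt_to_inv (F x)
  have hFlx : writtenInExtChartAt I J x F (φ x) = q₀ := by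
    change ψ (F (φ.symm (φ x))) = ψ (F x)
    rw [hφx]
  rw [hFlx] at hτω hτ₀ hFτ
  have hspan : ∀ v : E, ∃ o : E, o ∈ (orbitTangent IG I G x : Submodule ℝ E) ∧ ∃ w : E',
      o + fderiv ℝ τ q₀ w = v := by
    -- subtracting the image of `DF v` under the differential of `τ` from `v` leaves a vector of
    -- the kernel of `DF`
    intro v
    let D : E →L[ℝ] E' := fderiv ℝ (writtenInExtChartAt I J x F) (φ x)
    have hDτ : D ∘L fderiv ℝ τ q₀ = ContinuousLinearMap.id ℝ E' := by
      have h1 : HasFDerivAt τ (fderiv ℝ τ q₀) q₀ := (hτω.differentiableAt (by simp)).hasFDerivAt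
      have h2 : HasFDerivAt (writtenInExtChartAt I J x F) D (τ q₀) := by
        rw [hτ₀]; exact (hFl.differentiableAt (by simp)).hasFDerivAt
      exact (h2.comp q₀ h1).unique ((hasFDerivAt_id q₀).congr_of_eventuallyEq hFτ)
    refine ⟨v - fderiv ℝ τ q₀ (D v), ?_, D v, sub_add_cancel _ _⟩
    refine mem_orbitTangent_of_mfderiv_eq_zero hact hinv hFd hr hdim ?_
    refine (DFunLike.congr_fun hD _).trans ?_
    have h3 : D (fderiv ℝ τ q₀ (D v)) = D v := DFunLike.congr_fun hDτ (D v)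
    change D (v - fderiv ℝ τ q₀ (D v)) = 0
    rw [map_sub, h3, sub_self]
  let σ : Y → X := fun p => φ.symm (τ (ψ p))
  have hσx : σ (F x) = x := by simp only [σ, ← hq₀, hτ₀, hφx]
  have hσω : ∀ p ∈ ψ.source, ContDiffAt ℝ ω τ (ψ p) → τ (ψ p) ∈ φ.target →
      ContMDiffAt J I ω σ p := by
    intro p hp h1 h2
    have h3 : ContMDiffAt J 𝓘(ℝ, E') ω ψ p := contMDiffAt_extChartAt' (by simpa [hψ] using hp)
    have h4 : ContMDiffAt 𝓘(ℝ, E) I ω φ.symm (τ (ψ p)) :=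
      (contMDiffOn_extChartAt_symm x).contMDiffAt ((isOpen_extChartAt_target x).mem_nhds h2)
    exact ContMDiffAt.comp (g := φ.symm) p h4 (h1.contMDiffAt.comp p h3)
  have hψc : Tendsto ψ (𝓝 (F x)) (𝓝 q₀) := continuousAt_extChartAt (F x)
  have htgt : φ.target ∈ 𝓝 (τ q₀) := by rw [hτ₀]; exact extChartAt_target_mem_nhds x
  have hτt : ∀ᶠ p in 𝓝 (F x), τ (ψ p) ∈ φ.target :=
    hψc.eventually (hτω.continuousAt.preimage_mem_nhds htgt)
  have hτa : ∀ᶠ p in 𝓝 (F x), ContDiffAt ℝ ω τ (ψ p) :=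
    hψc.eventually (hτω.eventually (by simp))
  have hψs : ∀ᶠ p in 𝓝 (F x), p ∈ ψ.source := extChartAt_source_mem_nhds (F x)
  have hσs : ∀ᶠ p in 𝓝 (F x), ContMDiffAt J I ω σ p := by
    filter_upwards [hψs, hτa, hτt] with p h1 h2 h3 using hσω p h1 h2 h3
  have hσc : ContinuousAt σ (F x) := hσs.self_of_nhds.continuousAt
  have hFσs : ∀ᶠ p in 𝓝 (F x), F (σ p) ∈ ψ.source := by
    have h1 : ∀ᶠ y in 𝓝 (σ (F x)), F y ∈ ψ.source := by
      rw [hσx]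
      exact hFx.continuousAt.preimage_mem_nhds (extChartAt_source_mem_nhds (F x))
    exact hσc.eventually h1
  have hFσ : ∀ᶠ p in 𝓝 (F x), F (σ p) = p := by
    filter_upwards [hψs, hFσs, hψc.eventually hFτ] with p h1 h2 h3
    exact ψ.injOn h2 h1 h3
  obtain ⟨V₀, hV₀, hV₀o, hxV₀⟩ := eventually_nhds_iff.1 (hψs.and (hσs.and hFσ))
  have hN : {q | q ∈ ψ.target ∧ ψ.symm q ∈ V₀} ∈ 𝓝 q₀ := by
    have h1 : ψ.target ∈ 𝓝 q₀ := extChartAt_target_mem_nhds (F x)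
    have h2 : ContinuousAt ψ.symm q₀ := continuousAt_extChartAt_symm (F x)
    exact inter_mem h1 (h2.preimage_mem_nhds (by rw [hψx]; exact hV₀o.mem_nhds hxV₀))
  have hS := setOf_smul_slice_mem_nhds hact (hτω.of_le (by simp)) hτ₀ hspan hN
  rw [← hφ] at hS
  set S := {y | ∃ γ : G, ∃ q ∈ {q | q ∈ ψ.target ∧ ψ.symm q ∈ V₀}, y = γ • φ.symm (τ q)}
  -- shrink both sides, so that `F` maps into `V` and `σ` maps back
  let W₀ := U ∩ F ⁻¹' V₀ ∩ interior S
  have hW₀ : IsOpen W₀ :=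
    (hF.continuousOn.isOpen_inter_preimage hU hV₀o).inter isOpen_interior
  have hxW₀ : x ∈ W₀ := ⟨⟨hx, hxV₀⟩, mem_interior_iff_mem_nhds.2 hS⟩
  let V := V₀ ∩ σ ⁻¹' W₀
  have hσV₀ : ContinuousOn σ V₀ := fun p hp => (hV₀ p hp).2.1.continuousAt.continuousWithinAt
  have hV : IsOpen V := hσV₀.isOpen_inter_preimage hV₀o hW₀
  have hxV : F x ∈ V := ⟨hxV₀, by rw [mem_preimage, hσx]; exact hxW₀⟩
  refine ⟨U ∩ F ⁻¹' V ∩ W₀, V, σ, (hF.continuousOn.isOpen_inter_preimage hU hV).inter hW₀,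
    ⟨⟨hx, hxV⟩, hxW₀⟩, hV, fun y hy => hy.1.2, ?_,
    fun p hp => (hV₀ p hp.1).2.1.contMDiffWithinAt, hσx, fun p hp => (hV₀ p hp.1).2.2, ?_⟩
  · intro p hp
    refine ⟨⟨hp.2.1.1, ?_⟩, hp.2⟩
    rw [mem_preimage, (hV₀ p hp.1).2.2]
    exact hp
  · rintro y ⟨-, hyW₀⟩
    obtain ⟨γ, q, ⟨hqt, hqV⟩, hy⟩ := interior_subset hyW₀.2
    have hσq : σ (ψ.symm q) = φ.symm (τ q) := by simp only [σ, ψ.right_inv hqt]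
    have hFy : F y = ψ.symm q := by
      rw [hy, hinv, ← hσq, (hV₀ _ hqV).2.2]
    rw [hFy, hσq, hy]
    exact MulAction.mem_orbit _ _

/-- Sard's theorem for an invariant map whose orbits have complementary dimension: modulo the
symmetries, the critical values near `F x` are those of the restriction of `F` to a slice, which is
a map between spaces of equal dimension. -/
theorem exists_nhds_isNullSet_image_mfderivRank_lt [IsManifold I 1 X] [IsManifold J 1 Y]
    [MeasureSpace E'] [BorelSpace E'] [(volume : Measure E').IsAddHaarMeasure]
    (hact : ContMDiff (IG.prod I) I 1 (fun p : G × X => p.1 • p.2))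
    (hinv : ∀ (γ : G) (x : X), F (γ • x) = F x) (hU : IsOpen U) (hF : ContMDiffOn I J 1 F U)
    {x : X} (hx : x ∈ U) (hdim : orbitDim IG I G x + finrank ℝ E' = finrank ℝ E) :
    ∃ W ∈ 𝓝 x, IsNullSet J (F '' {y ∈ W | mfderivRank I J F y < finrank ℝ E'}) := by
  have hFx := hF.contMDiffAt (hU.mem_nhds hx)
  have hFl := contDiffAt_writtenInExtChartAt hFx
  have hrk := eventually_mfderivRank_eq hU hF hx
  set Fl := writtenInExtChartAt I J x F with hFldef
  set φ := extChartAt I x with hφ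
  set ψ := extChartAt J (F x) with hψ
  have hφs : Tendsto φ.symm (𝓝 (φ x)) (𝓝 x) := by
    have := continuousAt_extChartAt_symm (I := I) x
    rwa [ContinuousAt, extChartAt_to_inv] at this
  -- a complement of the tangent space of the orbit, parametrized by `E'`
  let O : Submodule ℝ E := orbitTangent IG I G x
  obtain ⟨C, hC⟩ := Submodule.exists_isCompl O
  have hCdim : finrank ℝ E' = finrank ℝ C := by
    have h1 := Submodule.finrank_add_eq_of_isCompl hC
    have h2 : orbitDim IG I G x = finrank ℝ O := rfl
    omega
  let c : E' ≃ₗ[ℝ] C := LinearEquiv.ofFinrankEq _ _ hCdim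
  let ι : E' →L[ℝ] E := (C.subtype ∘ₗ c.toLinearMap).toContinuousLinearMap
  let τ : E' → E := fun w => φ x + ι w
  have hτ : ContDiff ℝ 1 τ := contDiff_const.add ι.contDiff
  have hτ' : ∀ w, HasFDerivAt τ ι w := fun w => ι.hasFDerivAt.const_add (φ x)
  have hτ₀ : τ 0 = φ x := by simp [τ]
  have hspan : ∀ v : E, ∃ o : E, o ∈ (orbitTangent IG I G x : Submodule ℝ E) ∧ ∃ w : E',
      o + fderiv ℝ τ 0 w = v := by
    intro v
    have hv : v ∈ O ⊔ C := by
      rw [hC.sup_eq_top]; trivial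
    obtain ⟨o, ho, k, hk, hok⟩ := Submodule.mem_sup.1 hv
    refine ⟨o, ho, c.symm ⟨k, hk⟩, ?_⟩
    rw [(hτ' 0).fderiv, ← hok]
    simp [ι]
  have hτt : Tendsto τ (𝓝 0) (𝓝 (φ x)) := by
    have := hτ.continuous.tendsto 0
    rwa [hτ₀] at this
  have htgt : φ.target ∈ 𝓝 (φ x) := extChartAt_target_mem_nhds x
  have hFs : ∀ᶠ z in 𝓝 x, F z ∈ ψ.source :=
    hFx.continuousAt.preimage_mem_nhds (extChartAt_source_mem_nhds (F x))
  have hN : ∀ᶠ w in 𝓝 (0 : E'), τ w ∈ φ.target ∧ DifferentiableAt ℝ Fl (τ w) ∧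
      mfderivRank I J F (φ.symm (τ w)) = clmRank (fderiv ℝ Fl (φ (φ.symm (τ w)))) :=
    hτt.eventually (Filter.Eventually.and htgt (((hFl.eventually (by simp)).mono fun e he =>
      he.differentiableAt (by simp)).and (hφs.eventually hrk)))
  have hS := setOf_smul_slice_mem_nhds hact hτ.contDiffAt hτ₀ hspan hN
  refine ⟨_, inter_mem hS (inter_mem (hU.mem_nhds hx) hFs), ?_⟩
  refine isNullSet_of_volume_image_eq_zero (x := F x) ?_ ?_
  · rintro _ ⟨y, ⟨⟨-, -, hy⟩, -⟩, rfl⟩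
    exact hy
  -- the critical values come from critical points of the restriction of `F` to the slice
  let Z : Set E' := {w | DifferentiableAt ℝ Fl (τ w) ∧ (fderiv ℝ Fl (τ w) ∘L ι).det = 0}
  have hZ : volume ((Fl ∘ τ) '' Z) = 0 :=
    addHaar_image_eq_zero_of_det_fderivWithin_eq_zero (f' := fun w => fderiv ℝ Fl (τ w) ∘L ι)
      volume (fun w hw => (hw.1.hasFDerivAt.comp w (hτ' w)).hasFDerivWithinAt) fun w hw => hw.2
  refine measure_mono_null ?_ hZ
  rintro _ ⟨_, ⟨y, ⟨⟨⟨γ, w, ⟨hwt, hwd, hwr⟩, hy⟩, hyU, hyF⟩, hlt⟩, rfl⟩, rfl⟩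
  rw [← hφ] at hy
  refine ⟨w, ⟨hwd, ?_⟩, ?_⟩
  · by_contra hdet
    have hs : Function.Surjective (fderiv ℝ Fl (τ w) ∘L ι) :=
      (LinearMap.equivOfDetNeZero (fderiv ℝ Fl (τ w) ∘L ι).toLinearMap hdet).surjective
    have h1 := (clmRank_eq_codomain_iff _).2 hs
    have h2 := clmRank_comp_le_left (fderiv ℝ Fl (τ w)) ι
    rw [φ.right_inv hwt] at hwr
    have hyd : MDifferentiableAt I J F (γ • φ.symm (τ w)) := by
      rw [← hy]
      exact (hF.contMDiffAt (hU.mem_nhds hyU)).mdifferentiableAt (by simp)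
    have h3 := mfderivRank_le_smul hact hinv hyd
    rw [← hy] at h3
    omega
  · change ψ (F (φ.symm (τ w))) = ψ (F y)
    rw [hy, hinv]

end Invariant

section Invariant

variable {EG E E' HG H H' G X Y : Type*}
  [NormedAddCommGroup EG] [NormedSpace ℝ EG] [NormedAddCommGroup E] [NormedSpace ℝ E]
  [NormedAddCommGroup E'] [NormedSpace ℝ E']
  [TopologicalSpace HG] [TopologicalSpace H] [TopologicalSpace H']
  {IG : ModelWithCorners ℝ EG HG} {I : ModelWithCorners ℝ E H} {J : ModelWithCorners ℝ E' H'}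
  [TopologicalSpace G] [ChartedSpace HG G] [Group G]
  [TopologicalSpace X] [ChartedSpace H X] [TopologicalSpace Y] [ChartedSpace H' Y]
  [MulAction G X] {F : X → Y} {U : Set X}
  [IG.Boundaryless] [I.Boundaryless] [FiniteDimensional ℝ EG]
  [FiniteDimensional ℝ E] [FiniteDimensional ℝ E']
  [IsManifold I ω X] [IsManifold J ω Y]

theorem finrank_le_of_not_isNullSet_locallyRecoverable [SecondCountableTopology X]
    [SecondCountableTopology G]
    [MeasureSpace E] [BorelSpace E] [(volume : Measure E).IsAddHaarMeasure]
    (hact : ContMDiff (IG.prod I) I 1 (fun p : G × X => p.1 • p.2)) (hU : IsOpen U)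
    (hF : ContMDiffOn I J ω F U) (h : ¬ IsNullSet I {x ∈ U | LocallyRecoverableAt G F x}) :
    finrank ℝ E ≤ finrank ℝ E' + finrank ℝ EG := by
  have : IsManifold I 1 X := .of_le (n := ω) (by simp)
  have : IsManifold J 1 Y := .of_le (n := ω) (by simp)
  contrapose! h
  refine (isNullSet_not_eventually_mfderivRank_le hU hF).mono fun x hx => ⟨hx.1, fun hmax => ?_⟩
  exact h.not_ge (finrank_le_of_locallyRecoverableAt hact hU (hF.of_le (by simp)) hx.1 hmax hx.2)

variable [IsManifold IG 1 G] [J.Boundaryless]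

theorem mfderivRank_lt_of_not_locallyUniquelyInvertibleAt
    (hact : ContMDiff (IG.prod I) I 1 (fun p : G × X => p.1 • p.2))
    (hinv : ∀ (γ : G) (x : X), F (γ • x) = F x) (hU : IsOpen U) (hF : ContMDiffOn I J ω F U)
    {x : X} (hx : x ∈ U) (hdim : orbitDim IG I G x + finrank ℝ E' = finrank ℝ E)
    (h : ¬ LocallyUniquelyInvertibleAt I J G F x) : mfderivRank I J F x < finrank ℝ E' := by
  refine lt_of_le_of_ne (clmRank_le_codomain _) fun hr => h ?_
  exact locallyUniquelyInvertibleAt_of_mfderivRank_eq hact hinv hU hF hx hr hdim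

theorem isNullSet_image_not_locallyUniquelyInvertibleAt
    [SecondCountableTopology X] [MeasureSpace E'] [BorelSpace E']
    [(volume : Measure E').IsAddHaarMeasure]
    (hact : ContMDiff (IG.prod I) I 1 (fun p : G × X => p.1 • p.2))
    (hinv : ∀ (γ : G) (x : X), F (γ • x) = F x) (hU : IsOpen U) (hF : ContMDiffOn I J ω F U)
    (hdim : ∀ x ∈ U, orbitDim IG I G x + finrank ℝ E' = finrank ℝ E) :
    IsNullSet J (F '' {x ∈ U | ¬ LocallyUniquelyInvertibleAt I J G F x}) := by
  have : IsManifold I 1 X := .of_le (n := ω) (by simp)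
  have : IsManifold J 1 Y := .of_le (n := ω) (by simp)
  have hloc : ∀ x ∈ U, ∃ W ∈ 𝓝 x,
      IsNullSet J (F '' {y ∈ W | mfderivRank I J F y < finrank ℝ E'}) := fun x hx =>
    exists_nhds_isNullSet_image_mfderivRank_lt hact hinv hU (hF.of_le (by simp)) hx (hdim x hx)
  choose! W hW hnull using hloc
  obtain ⟨t, htU, htc, hcov⟩ := TopologicalSpace.countable_cover_nhdsWithin (f := W) (s := U)
    (fun x hx => mem_nhdsWithin_of_mem_nhds (hW x hx))
  refine (IsNullSet.biUnion htc fun x hx => hnull x (htU hx)).mono ?_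
  rintro _ ⟨x, ⟨hx, hnot⟩, rfl⟩
  obtain ⟨i, hi, hxi⟩ := mem_iUnion₂.1 (hcov hx)
  exact mem_iUnion₂.2 ⟨i, hi, x, ⟨hxi,
    mfderivRank_lt_of_not_locallyUniquelyInvertibleAt hact hinv hU hF hx (hdim x hx) hnot⟩, rfl⟩

theorem isNullSet_not_locallyUniquelyInvertibleAt
    [SecondCountableTopology X] [MeasureSpace E] [BorelSpace E]
    [(volume : Measure E).IsAddHaarMeasure]
    (hact : ContMDiff (IG.prod I) I 1 (fun p : G × X => p.1 • p.2))
    (hinv : ∀ (γ : G) (x : X), F (γ • x) = F x) (hU : IsOpen U) (hF : ContMDiffOn I J ω F U)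
    (hdim : ∀ x ∈ U, orbitDim IG I G x + finrank ℝ E' = finrank ℝ E) {C : Set X}
    (hC : IsPreconnected C) (hCU : C ⊆ U) {x₀ : X} (hx₀ : x₀ ∈ C)
    (hr : mfderivRank I J F x₀ = finrank ℝ E') :
    IsNullSet I {x ∈ C | ¬ LocallyUniquelyInvertibleAt I J G F x} := by
  have : IsManifold I 1 X := .of_le (n := ω) (by simp)
  have : IsManifold J 1 Y := .of_le (n := ω) (by simp)
  exact (isNullSet_mfderivRank_lt hU hF hC hCU hx₀ hr).mono fun x hx => ⟨hx.1,
    mfderivRank_lt_of_not_locallyUniquelyInvertibleAt hact hinv hU hF (hCU hx.1)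
      (hdim x (hCU hx.1)) hx.2⟩

end Invariant

/-! ### The configuration space -/

section Configurations

theorem finrank_configModel (h f d m n : ℕ) :
    finrank ℝ (EuclideanSpace ℝ (Fin h) × (Fin m → EuclideanSpace ℝ (Fin f)) ×
      (Fin n → EuclideanSpace ℝ (Fin d))) = d * n + f * m + h := by
  simp only [finrank_prod, finrank_pi_fintype, finrank_euclideanSpace_fin, Finset.sum_const,
    Finset.card_univ, Fintype.card_fin, smul_eq_mul]
  ring

theorem finrank_imageModel (s m n : ℕ) :
    finrank ℝ (Fin m × Fin n → EuclideanSpace ℝ (Fin s)) = s * n * m := by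
  simp only [finrank_pi_fintype, finrank_euclideanSpace_fin, Finset.sum_const,
    Finset.card_univ, Fintype.card_prod, Fintype.card_fin, smul_eq_mul]
  ring

theorem isAddHaarMeasure_volume_configModel (h f d m n : ℕ) :
    (volume : Measure (EuclideanSpace ℝ (Fin h) × (Fin m → EuclideanSpace ℝ (Fin f)) ×
      (Fin n → EuclideanSpace ℝ (Fin d)))).IsAddHaarMeasure := by
  have : (volume : Measure ((Fin m → EuclideanSpace ℝ (Fin f)) ×
      (Fin n → EuclideanSpace ℝ (Fin d)))).IsAddHaarMeasure :=
    Measure.prod.instIsAddHaarMeasure volume volume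
  exact Measure.prod.instIsAddHaarMeasure volume volume

theorem CameraType.sfmMap_smul {d s : ℕ} {Θ M N S : Type*}
    [TopologicalSpace N] [ChartedSpace (EuclideanSpace ℝ (Fin d)) N]
    [TopologicalSpace S] [ChartedSpace (EuclideanSpace ℝ (Fin s)) S]
    {C : CameraType d s Θ M N S} {G : Type*} [Group G] [MulAction G Θ] [MulAction G M]
    [MulAction G N] (hG : C.IsSymmetryGroup G) (m n : ℕ) (γ : G) (x : Config Θ M N m n) :
    C.sfmMap m n (γ • x) = C.sfmMap m n x :=
  funext fun ji => hG γ x.1 (x.2.1 ji.1) (x.2.2 ji.2)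

theorem contMDiff_smul_config {d f h g m n : ℕ} {N M Θ G : Type*}
    [TopologicalSpace N] [ChartedSpace (EuclideanSpace ℝ (Fin d)) N]
    [TopologicalSpace M] [ChartedSpace (EuclideanSpace ℝ (Fin f)) M]
    [TopologicalSpace Θ] [ChartedSpace (EuclideanSpace ℝ (Fin h)) Θ]
    [Group G] [TopologicalSpace G] [ChartedSpace (EuclideanSpace ℝ (Fin g)) G]
    [MulAction G N] [ContMDiffSMul (𝓡 g) (𝓡 d) ∞ G N]
    [MulAction G M] [ContMDiffSMul (𝓡 g) (𝓡 f) ∞ G M]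
    [MulAction G Θ] [ContMDiffSMul (𝓡 g) (𝓡 h) ∞ G Θ] :
    ContMDiff ((𝓡 g).prod (configModel h f d m n)) (configModel h f d m n) ∞
      (fun p : G × Config Θ M N m n => p.1 • p.2) := by
  have h2 : ContMDiff ((𝓡 g).prod (configModel h f d m n)) _ ∞
      (fun p : G × Config Θ M N m n => p.2) := contMDiff_snd
  have hγ : ContMDiff ((𝓡 g).prod (configModel h f d m n)) (𝓡 g) ∞
      (fun p : G × Config Θ M N m n => p.1) := contMDiff_fst
  refine ContMDiff.prodMk ?_ (ContMDiff.prodMk ?_ ?_)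
  · exact (contMDiff_smul (I := 𝓡 g) (I' := 𝓡 h) (n := ∞)).comp
      (hγ.prodMk (contMDiff_fst.comp h2))
  · refine contMDiff_pi fun j => ?_
    exact (contMDiff_smul (I := 𝓡 g) (I' := 𝓡 f) (n := ∞)).comp
      (hγ.prodMk ((contMDiff_eval j).comp (contMDiff_fst.comp (contMDiff_snd.comp h2))))
  · refine contMDiff_pi fun i => ?_
    exact (contMDiff_smul (I := 𝓡 g) (I' := 𝓡 d) (n := ∞)).comp
      (hγ.prodMk ((contMDiff_eval i).comp (contMDiff_snd.comp (contMDiff_snd.comp h2))))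

end Configurations

end StructureFromMotion

open StructureFromMotion in
theorem mainTheorem1 (d f h g s m n : ℕ)
    (N : Type*) [TopologicalSpace N] [T2Space N] [SecondCountableTopology N]
    [ChartedSpace (EuclideanSpace ℝ (Fin d)) N] [IsManifold (𝓡 d) ω N]
    (M : Type*) [TopologicalSpace M] [T2Space M] [SecondCountableTopology M]
    [ChartedSpace (EuclideanSpace ℝ (Fin f)) M] [IsManifold (𝓡 f) ω M]
    (Θ : Type*) [TopologicalSpace Θ] [T2Space Θ] [SecondCountableTopology Θ]
    [ChartedSpace (EuclideanSpace ℝ (Fin h)) Θ] [IsManifold (𝓡 h) ω Θ]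
    (S : Type*) [TopologicalSpace S] [T2Space S] [SecondCountableTopology S]
    [ChartedSpace (EuclideanSpace ℝ (Fin s)) S] [IsManifold (𝓡 s) ω S]
    (G : Type*) [Group G] [TopologicalSpace G] [T2Space G] [SecondCountableTopology G]
    [ChartedSpace (EuclideanSpace ℝ (Fin g)) G] [LieGroup (𝓡 g) ∞ G]
    [MulAction G N] [ContMDiffSMul (𝓡 g) (𝓡 d) ∞ G N]
    [MulAction G M] [ContMDiffSMul (𝓡 g) (𝓡 f) ∞ G M]
    [MulAction G Θ] [ContMDiffSMul (𝓡 g) (𝓡 h) ∞ G Θ]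
    (C : CameraType d s Θ M N S) (hG : C.IsSymmetryGroup G)
    (U : Set (Config Θ M N m n)) (hU : IsOpen U)
    (hF : ContMDiffOn (configModel h f d m n) (imageModel s m n) ω (C.sfmMap m n) U)
    (horb : ∃ k : ℕ, ∀ x ∈ U, orbitDim (𝓡 g) (configModel h f d m n) G x = k) :
    (¬ IsNullSet (configModel h f d m n) {x ∈ U | LocallyRecoverableAt G (C.sfmMap m n) x} →
      d * n + f * m + h ≤ s * n * m + g) ∧
    (d * n + f * m + h = s * n * m + g →
      (∃ x ∈ U, JacobianDetNeZero (𝓡 g) (configModel h f d m n) (imageModel s m n) G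
        (C.sfmMap m n) x) →
      IsNullSet (imageModel s m n)
        (C.sfmMap m n '' {x ∈ U | ¬ LocallyUniquelyInvertibleAt (configModel h f d m n)
          (imageModel s m n) G (C.sfmMap m n) x}) ∧
      ∀ x₀ ∈ U, JacobianDetNeZero (𝓡 g) (configModel h f d m n) (imageModel s m n) G
          (C.sfmMap m n) x₀ →
        IsNullSet (configModel h f d m n)
          {x ∈ connectedComponentIn U x₀ | ¬ LocallyUniquelyInvertibleAt (configModel h f d m n)
            (imageModel s m n) G (C.sfmMap m n) x}) := by
  have hbM : (ModelWithCorners.pi fun _ : Fin m => 𝓡 f).Boundaryless :=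
    boundaryless_pi fun _ => inferInstance
  have hbN : (ModelWithCorners.pi fun _ : Fin n => 𝓡 d).Boundaryless :=
    boundaryless_pi fun _ => inferInstance
  have hbS : (imageModel s m n).Boundaryless := boundaryless_pi fun _ => inferInstance
  have hmM : IsManifold (ModelWithCorners.pi fun _ : Fin m => 𝓡 f) ω (Fin m → M) :=
    isManifold_pi fun _ => inferInstance
  have hmN : IsManifold (ModelWithCorners.pi fun _ : Fin n => 𝓡 d) ω (Fin n → N) :=
    isManifold_pi fun _ => inferInstance
  have hmS : IsManifold (imageModel s m n) ω (Fin m × Fin n → S) :=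
    isManifold_pi fun _ => inferInstance
  have hmG : IsManifold (𝓡 g) 1 G :=
    have : IsManifold (𝓡 g) ∞ G := inferInstance
    .of_le (n := ∞) (by simp)
  have hact : ContMDiff ((𝓡 g).prod (configModel h f d m n)) (configModel h f d m n) 1
      (fun p : G × Config Θ M N m n => p.1 • p.2) := contMDiff_smul_config.of_le (by simp)
  have hinv := C.sfmMap_smul hG m n
  have hvol := isAddHaarMeasure_volume_configModel h f d m n
  obtain ⟨k, hk⟩ := horb
  constructor
  · intro hnull
    have := finrank_le_of_not_isNullSet_locallyRecoverable hact hU hF hnull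
    rwa [finrank_configModel, finrank_imageModel, finrank_euclideanSpace_fin] at this
  · rintro - ⟨x₁, hx₁, hdet₁⟩
    have hdim := (mfderivRank_eq_and_finrank_eq_of_jacobianDetNeZero hdet₁).2
    have hdimU : ∀ x ∈ U, orbitDim (𝓡 g) (configModel h f d m n) G x + Module.finrank ℝ
        (Fin m × Fin n → EuclideanSpace ℝ (Fin s)) = Module.finrank ℝ
        (EuclideanSpace ℝ (Fin h) × (Fin m → EuclideanSpace ℝ (Fin f)) ×
          (Fin n → EuclideanSpace ℝ (Fin d))) := fun x hx => by
      rw [hk x hx, ← hk x₁ hx₁]; exact hdim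
    refine ⟨isNullSet_image_not_locallyUniquelyInvertibleAt hact hinv hU hF hdimU, ?_⟩
    intro x₀ hx₀ hdet₀
    exact isNullSet_not_locallyUniquelyInvertibleAt hact hinv hU hF hdimU
      isPreconnected_connectedComponentIn (connectedComponentIn_subset U x₀)
      (mem_connectedComponentIn hx₀) (mfderivRank_eq_and_finrank_eq_of_jacobianDetNeZero hdet₀).1
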